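/- Let $I=[0,1]$ or $I=[0,\infty)$ and let $1\le p<\infty$. The Cesàro function space $Ces_p(I)$ consists of all (classes, modulo equality almost everywhere, of) Lebesgue measurable functions $f:I\to\mathbb R$ such that $$\|f\|_{C(p)}=\left[\int_I\left(\frac1x\int_0^x|f(t)|\,dt\right)^p dx\right]^{1/p}<\infty ,$$ and it is a Banach space with the norm $\|\cdot\|_{C(p)}$. **Theorem 1.** For every $1\le p<\infty$ the space $Ces_p(I)$ has the weak Banach–Saks property: every sequence $(f_n)$ in $Ces_p(I)$ that converges weakly to $0$ has a subsequence $(f_{n_k})$ such that $$\lim_{m\to\infty}\frac1m\left\|\sum_{k=1}^m f_{n_k}\right\|_{C(p)}=0 .$$ -/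

import Mathlib

open MeasureTheory Filter Topology Set
open scoped ENNReal

noncomputable section

/-- A real Banach space `X` has the weak Banach–Saks property if every weakly null sequence `x`
has a subsequence whose arithmetical means converge to zero in norm. -/
def WeakBanachSaks (X : Type*) [NormedAddCommGroup X] [NormedSpace ℝ X] [CompleteSpace X] :
    Prop :=
  ∀ x : ℕ → X, (∀ φ : StrongDual ℝ X, Tendsto (fun n => φ (x n)) atTop (𝓝 0)) →
    ∃ n : ℕ → ℕ, StrictMono n ∧
      Tendsto (fun m : ℕ => (1 / (m : ℝ)) * ‖∑ k ∈ Finset.range m, x (n k)‖) atTop (𝓝 0)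

/-- The two possible underlying intervals: `[0, 1]` and `[0, ∞)`. -/
inductive CesDomain
  | unitInterval
  | halfLine

namespace CesDomain

/-- The interval as a set of reals. -/
def toSet : CesDomain → Set ℝ
  | unitInterval => Icc 0 1
  | halfLine => Ici 0

/-- Lebesgue measure on the interval. -/
def measure (I : CesDomain) : Measure ℝ := volume.restrict I.toSet

end CesDomain

/-- `[∫_I ((1/x) ∫_0^x g(t) dt)^p dx]^(1/p)` for a nonnegative function `g`. Both integrals are
taken with respect to Lebesgue measure on `I`; note that `(0, x] ⊆ I` for `x ∈ I`. -/
def cesLint (p : ℝ) (I : CesDomain) (g : ℝ → ℝ≥0∞) : ℝ≥0∞ :=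
  (∫⁻ x, ((∫⁻ t in Ioc 0 x, g t ∂I.measure) / ENNReal.ofReal x) ^ p ∂I.measure) ^ (1 / p)

namespace CesDomain

lemma toSet_measurable (I : CesDomain) : MeasurableSet I.toSet := by
  cases I <;> simp [toSet]

lemma ae_of_ae_Ioc (I : CesDomain) {Q R : ℝ → Prop} (hQ : ∀ᵐ x ∂I.measure, Q x)
    (hR : ∀ x, 0 < x → Q x → ∀ᵐ t ∂I.measure.restrict (Ioc 0 x), R t) :
    ∀ᵐ t ∂I.measure, R t := by
  have key : ∀ a b : ℝ, 0 ≤ a → a < b → Ioo a b ⊆ I.toSet → ∃ x ∈ Ioo a b, Q x := by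
    intro a b _ hab hsub
    have h1 : ∀ᵐ x ∂volume.restrict (Ioo a b), Q x :=
      ae_mono (Measure.restrict_mono hsub le_rfl) hQ
    rw [ae_restrict_iff' measurableSet_Ioo] at h1
    by_contra! hcon
    have h2 : volume (Ioo a b) = 0 := by
      refine measure_mono_null ?_ (ae_iff.1 h1)
      intro x hx
      exact fun h => hcon x hx (h hx)
    rw [Real.volume_Ioo] at h2
    simp only [ENNReal.ofReal_eq_zero] at h2
    linarith
  have hne : ∀ c : ℝ, ∀ᵐ t ∂I.measure, t ≠ c := fun c =>
    ae_mono Measure.restrict_le_self (Measure.ae_ne volume c)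
  have hmem : ∀ᵐ t ∂I.measure, t ∈ I.toSet := ae_restrict_mem I.toSet_measurable
  obtain ⟨y, hy0, hyQ, hyc⟩ : ∃ y : ℕ → ℝ, (∀ n, 0 < y n) ∧ (∀ n, Q (y n)) ∧
      ∀ t ∈ I.toSet, t ≠ 1 → ∃ n, t ≤ y n := by
    cases I with
    | unitInterval =>
      have h (n : ℕ) : ∃ x ∈ Ioo (1 - 1 / ((n : ℝ) + 1)) 1, Q x := by
        have hn : (0 : ℝ) < 1 / ((n : ℝ) + 1) := by positivity
        have hn1 : 1 / ((n : ℝ) + 1) ≤ 1 := by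
          rw [div_le_one (by positivity)]; linarith [(Nat.cast_nonneg n : (0 : ℝ) ≤ n)]
        refine key _ _ (by linarith) (by linarith) fun x hx => ?_
        exact ⟨by linarith [hx.1], hx.2.le⟩
      choose y hy hyQ using h
      refine ⟨y, fun n => ?_, hyQ, fun t ht ht1 => ?_⟩
      · have hn1 : 1 / ((n : ℝ) + 1) ≤ 1 := by
          rw [div_le_one (by positivity)]; linarith [(Nat.cast_nonneg n : (0 : ℝ) ≤ n)]
        linarith [(hy n).1]
      · have : 0 < 1 - t := sub_pos.2 (lt_of_le_of_ne ht.2 ht1)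
        obtain ⟨n, hn⟩ := exists_nat_one_div_lt this
        exact ⟨n, by linarith [(hy n).1]⟩
    | halfLine =>
      have h (n : ℕ) : ∃ x ∈ Ioo (n : ℝ) (n + 1), Q x := by
        refine key _ _ (Nat.cast_nonneg n) (by linarith) fun x hx => ?_
        exact le_trans (Nat.cast_nonneg n) hx.1.le
      choose y hy hyQ using h
      refine ⟨y, fun n => lt_of_le_of_lt (Nat.cast_nonneg n) (hy n).1, hyQ, fun t _ _ => ?_⟩
      obtain ⟨n, hn⟩ := exists_nat_ge t
      exact ⟨n, hn.trans (hy n).1.le⟩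
  have hall : ∀ᵐ t ∂I.measure, ∀ n, t ∈ Ioc 0 (y n) → R t :=
    ae_all_iff.2 fun n => (ae_restrict_iff' measurableSet_Ioc).1 (hR _ (hy0 n) (hyQ n))
  filter_upwards [hall, hmem, hne 0, hne 1] with t h1 h2 h3 h4
  obtain ⟨n, hn⟩ := hyc t h2 h4
  have h0 : 0 ≤ t := by
    cases I with
    | unitInterval => exact h2.1
    | halfLine => exact h2
  exact h1 n ⟨lt_of_le_of_ne h0 (Ne.symm h3), hn⟩

end CesDomain

section CesLint

variable {p : ℝ} {I : CesDomain} {f g : ℝ → ℝ≥0∞}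

lemma cesLint_mono_ae (hp : 1 ≤ p) (h : ∀ᵐ t ∂I.measure, f t ≤ g t) :
    cesLint p I f ≤ cesLint p I g := by
  have hp0 : 0 ≤ p := by linarith
  refine ENNReal.rpow_le_rpow (lintegral_mono fun x => ?_) (by positivity)
  refine ENNReal.rpow_le_rpow (ENNReal.div_le_div_right ?_ _) hp0
  exact lintegral_mono_ae (ae_restrict_of_ae h)

lemma cesLint_congr_ae (hp : 1 ≤ p) (h : ∀ᵐ t ∂I.measure, f t = g t) :
    cesLint p I f = cesLint p I g :=
  le_antisymm (cesLint_mono_ae hp (h.mono fun _ h => h.le))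
    (cesLint_mono_ae hp (h.mono fun _ h => h.ge))

lemma measurable_cesMean (I : CesDomain) (g : ℝ → ℝ≥0∞) :
    Measurable fun x : ℝ => (∫⁻ t in Ioc 0 x, g t ∂I.measure) / ENNReal.ofReal x := by
  have : Monotone fun x : ℝ => ∫⁻ t in Ioc 0 x, g t ∂I.measure := fun x y hxy =>
    lintegral_mono_set (Ioc_subset_Ioc_right hxy)
  exact this.measurable.div ENNReal.measurable_ofReal

lemma cesLint_zero (hp : 1 ≤ p) : cesLint p I (fun _ => 0) = 0 := by
  have hp0 : 0 < p := by linarith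
  simp [cesLint, ENNReal.zero_rpow_of_pos hp0, hp0]

lemma cesLint_add_le (hp : 1 ≤ p) (hf : AEMeasurable f I.measure) :
    cesLint p I (fun t => f t + g t) ≤ cesLint p I f + cesLint p I g := by
  refine le_trans (le_of_eq ?_) (ENNReal.lintegral_Lp_add_le
    (measurable_cesMean I f).aemeasurable (measurable_cesMean I g).aemeasurable hp)
  unfold cesLint
  congr 2
  ext x
  rw [lintegral_add_left' hf.restrict, ENNReal.add_div]
  rfl

lemma cesLint_const_mul (hp : 1 ≤ p) {c : ℝ≥0∞} (hc : c ≠ ∞) :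
    cesLint p I (fun t => c * g t) = c * cesLint p I g := by
  have hp0 : 0 < p := by linarith
  unfold cesLint
  have : ∀ x : ℝ, ((∫⁻ t in Ioc 0 x, c * g t ∂I.measure) / ENNReal.ofReal x) ^ p =
      c ^ p * ((∫⁻ t in Ioc 0 x, g t ∂I.measure) / ENNReal.ofReal x) ^ p := fun x => by
    rw [lintegral_const_mul' _ _ hc, mul_div_assoc, ENNReal.mul_rpow_of_nonneg _ _ hp0.le]
  simp_rw [this]
  rw [lintegral_const_mul' _ _ (ENNReal.rpow_ne_top_of_nonneg hp0.le hc),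
    ENNReal.mul_rpow_of_nonneg _ _ (by positivity), ← ENNReal.rpow_mul,
    mul_one_div_cancel hp0.ne', ENNReal.rpow_one]

lemma cesLint_eq_zero (hp : 1 ≤ p) (hg : AEMeasurable g I.measure) (h : cesLint p I g = 0) :
    ∀ᵐ t ∂I.measure, g t = 0 := by
  have hp0 : 0 < p := by linarith
  rw [cesLint, ENNReal.rpow_eq_zero_iff_of_pos (by positivity),
    lintegral_eq_zero_iff ((measurable_cesMean I g).pow_const p)] at h
  refine I.ae_of_ae_Ioc h fun x _ hx => ?_
  simp only [Pi.zero_apply, ENNReal.rpow_eq_zero_iff_of_pos hp0, ENNReal.div_eq_zero_iff,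
    ENNReal.ofReal_ne_top, or_false] at hx
  exact (lintegral_eq_zero_iff' hg.restrict).1 hx

lemma cesLint_ae_lt_top (hp : 1 ≤ p) (hg : AEMeasurable g I.measure) (h : cesLint p I g ≠ ∞) :
    ∀ᵐ t ∂I.measure, g t < ∞ := by
  have hp0 : 0 < p := by linarith
  have h1 : ∫⁻ x, ((∫⁻ t in Ioc 0 x, g t ∂I.measure) / ENNReal.ofReal x) ^ p ∂I.measure ≠ ∞ := by
    intro h2
    exact h (by rw [cesLint, h2, ENNReal.top_rpow_of_pos (by positivity)])
  have h2 := ae_lt_top ((measurable_cesMean I g).pow_const p) h1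
  refine I.ae_of_ae_Ioc h2 fun x hx0 hx => ?_
  refine ae_lt_top' hg.restrict fun h3 => ?_
  rw [h3, ENNReal.top_div_of_ne_top ENNReal.ofReal_ne_top, ENNReal.top_rpow_of_pos hp0] at hx
  exact lt_irrefl _ hx

lemma cesLint_iSup (hp : 1 ≤ p) {F : ℕ → ℝ → ℝ≥0∞} (hF : ∀ n, AEMeasurable (F n) I.measure)
    (hmono : ∀ t, Monotone fun n => F n t) :
    cesLint p I (fun t => ⨆ n, F n t) = ⨆ n, cesLint p I (F n) := by
  have hp0 : 0 < p := by linarith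
  have hsup : ∀ {q : ℝ} (_ : 0 < q) (u : ℕ → ℝ≥0∞), (⨆ n, u n) ^ q = ⨆ n, u n ^ q :=
    fun hq u => (ENNReal.orderIsoRpow _ hq).map_iSup u
  unfold cesLint
  rw [← hsup (by positivity), ← lintegral_iSup]
  · congr 2
    ext x
    rw [lintegral_iSup' (fun n => (hF n).restrict) (ae_of_all _ hmono), ENNReal.iSup_div,
      hsup hp0]
  · exact fun n => (measurable_cesMean I (F n)).pow_const p
  · intro m n hmn x
    refine ENNReal.rpow_le_rpow (ENNReal.div_le_div_right ?_ _) hp0.le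
    exact lintegral_mono fun t => hmono t hmn

lemma cesLint_tsum_le (hp : 1 ≤ p) {F : ℕ → ℝ → ℝ≥0∞} (hF : ∀ n, AEMeasurable (F n) I.measure) :
    cesLint p I (fun t => ∑' n, F n t) ≤ ∑' n, cesLint p I (F n) := by
  simp_rw [ENNReal.tsum_eq_iSup_nat]
  rw [cesLint_iSup hp (F := fun n t => ∑ i ∈ Finset.range n, F i t)]
  · refine iSup_mono fun n => ?_
    induction n with
    | zero => simpa using (cesLint_zero hp).le
    | succ n ih =>
      simp_rw [Finset.sum_range_succ]
      refine (cesLint_add_le hp (Finset.aemeasurable_fun_sum _ fun i _ => hF i)).trans ?_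
      exact add_le_add_left ih _
  · exact fun n => Finset.aemeasurable_fun_sum _ fun i _ => hF i
  · intro t m n hmn
    exact Finset.sum_le_sum_of_subset (Finset.range_mono hmn)

end CesLint

/-- The extended norm `‖f‖_{C(p)} ∈ [0, ∞]` of an a.e. class of measurable functions on `I`. -/
def cesENorm (p : ℝ) (I : CesDomain) (f : ℝ →ₘ[I.measure] ℝ) : ℝ≥0∞ :=
  cesLint p I fun t => ‖f t‖ₑ

section CesENorm

variable {p : ℝ} {I : CesDomain}

lemma aemeasurable_enorm (f : ℝ →ₘ[I.measure] ℝ) :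
    AEMeasurable (fun t => ‖f t‖ₑ) I.measure :=
  f.aestronglyMeasurable.enorm

lemma cesENorm_zero (hp : 1 ≤ p) : cesENorm p I 0 = 0 := by
  rw [← cesLint_zero (I := I) hp]
  refine cesLint_congr_ae hp ?_
  filter_upwards [AEEqFun.coeFn_zero (α := ℝ) (β := ℝ) (μ := I.measure)] with t ht
  simp [ht]

lemma cesENorm_add_le (hp : 1 ≤ p) (f g : ℝ →ₘ[I.measure] ℝ) :
    cesENorm p I (f + g) ≤ cesENorm p I f + cesENorm p I g := by
  refine (cesLint_mono_ae hp ?_).trans (cesLint_add_le hp (aemeasurable_enorm f))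
  filter_upwards [AEEqFun.coeFn_add f g] with t ht
  rw [ht]
  exact enorm_add_le _ _

lemma cesENorm_smul (hp : 1 ≤ p) (c : ℝ) (f : ℝ →ₘ[I.measure] ℝ) :
    cesENorm p I (c • f) = ‖c‖ₑ * cesENorm p I f := by
  rw [cesENorm, cesENorm, ← cesLint_const_mul hp enorm_ne_top]
  refine cesLint_congr_ae hp ?_
  filter_upwards [AEEqFun.coeFn_smul c f] with t ht
  simp [ht, enorm_mul]

lemma cesENorm_eq_zero (hp : 1 ≤ p) {f : ℝ →ₘ[I.measure] ℝ} (h : cesENorm p I f = 0) :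
    f = 0 := by
  apply AEEqFun.ext
  filter_upwards [cesLint_eq_zero hp (aemeasurable_enorm f) h,
    AEEqFun.coeFn_zero (α := ℝ) (β := ℝ) (μ := I.measure)] with t h1 h2
  rw [h2]
  simpa using h1

end CesENorm

/-- The Cesàro function space `Ces_p(I)`: all (a.e. classes of) Lebesgue measurable real functions
`f` on `I` with `‖f‖_{C(p)} < ∞`. -/
def Ces (p : ℝ) [hp : Fact (1 ≤ p)] (I : CesDomain) : Submodule ℝ (ℝ →ₘ[I.measure] ℝ) where
  carrier := {f | cesENorm p I f < ∞}
  zero_mem' := by simp [cesENorm_zero hp.out]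
  add_mem' := fun {f g} hf hg =>
    (cesENorm_add_le hp.out f g).trans_lt (ENNReal.add_lt_top.2 ⟨hf, hg⟩)
  smul_mem' := fun c f hf => by
    change cesENorm p I (c • f) < ∞
    rw [cesENorm_smul hp.out]
    exact ENNReal.mul_lt_top enorm_lt_top hf

namespace Ces

variable {p : ℝ} [hp : Fact (1 ≤ p)] {I : CesDomain}

lemma ne_top (f : Ces p I) : cesENorm p I f.1 ≠ ∞ := ne_of_lt f.2

/-- The norm of `Ces_p(I)`. -/
instance instNorm : Norm (Ces p I) := ⟨fun f => (cesENorm p I f.1).toReal⟩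

lemma norm_def (f : Ces p I) : ‖f‖ = (cesENorm p I f.1).toReal := rfl

lemma core : NormedSpace.Core ℝ (Ces p I) where
  norm_nonneg _ := ENNReal.toReal_nonneg
  norm_smul c f := by
    rw [norm_def, norm_def, Submodule.coe_smul, cesENorm_smul hp.out, ENNReal.toReal_mul]
    simp
  norm_triangle f g := by
    rw [norm_def, norm_def, norm_def, ← ENNReal.toReal_add (ne_top f) (ne_top g)]
    exact ENNReal.toReal_mono (ENNReal.add_ne_top.2 ⟨(ne_top f), (ne_top g)⟩)
      (cesENorm_add_le hp.out f.1 g.1)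
  norm_eq_zero_iff f := by
    constructor
    · intro h
      rw [norm_def, ENNReal.toReal_eq_zero_iff] at h
      exact Subtype.ext (cesENorm_eq_zero hp.out (h.resolve_right (ne_top f)))
    · rintro rfl
      simp [norm_def, cesENorm_zero hp.out]

instance instNormedAddCommGroup : NormedAddCommGroup (Ces p I) := NormedAddCommGroup.ofCore core

instance instNormedSpace : NormedSpace ℝ (Ces p I) := NormedSpace.ofCore core

instance instCompleteSpace : CompleteSpace (Ces p I) := by
  apply NormedAddCommGroup.completeSpace_of_summable_imp_tendsto
  intro u hu
  have hu' : ∑' n, cesENorm p I (u n).1 ≠ ∞ := by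
    have h1 : ∀ n, cesENorm p I (u n).1 = ENNReal.ofReal ‖u n‖ := fun n =>
      (ENNReal.ofReal_toReal (ne_top (u n))).symm
    simp_rw [h1]
    exact hu.tsum_ofReal_ne_top
  set F : ℕ → ℝ → ℝ≥0∞ := fun n t => ‖(u n).1 t‖ₑ with hF
  have hFm : ∀ n, AEMeasurable (F n) I.measure := fun n => aemeasurable_enorm _
  have hfin : ∀ᵐ t ∂I.measure, ∑' n, F n t < ∞ :=
    cesLint_ae_lt_top hp.out (AEMeasurable.tsum hFm)
      (ne_top_of_le_ne_top hu' (cesLint_tsum_le hp.out hFm))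
  have hsum : ∀ᵐ t ∂I.measure, Summable fun n => (u n).1 t := by
    filter_upwards [hfin] with t ht
    refine Summable.of_norm ?_
    have := ENNReal.summable_toReal ht.ne
    simpa [hF] using this
  have hlim : ∀ᵐ t ∂I.measure, Tendsto (fun N => ∑ n ∈ Finset.range N, (u n).1 t) atTop
      (𝓝 (∑' n, (u n).1 t)) := hsum.mono fun t ht => ht.hasSum.tendsto_sum_nat
  have hmeas : AEStronglyMeasurable (fun t => ∑' n, (u n).1 t) I.measure :=
    aestronglyMeasurable_of_tendsto_ae atTop
      (fun N => Finset.aestronglyMeasurable_fun_sum _ fun n _ => (u n).1.aestronglyMeasurable) hlim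
  set S : ℝ →ₘ[I.measure] ℝ := AEEqFun.mk _ hmeas with hS
  have hpart : ∀ N, ∀ᵐ t ∂I.measure,
      (∑ n ∈ Finset.range N, u n : Ces p I).1 t = ∑ n ∈ Finset.range N, (u n).1 t := by
    intro N
    induction N with
    | zero =>
      filter_upwards [AEEqFun.coeFn_zero (α := ℝ) (β := ℝ) (μ := I.measure)] with t ht
      simpa using ht
    | succ N ih =>
      filter_upwards [ih, AEEqFun.coeFn_add (∑ n ∈ Finset.range N, u n : Ces p I).1 (u N).1]
        with t h1 h2
      rw [Finset.sum_range_succ, Finset.sum_range_succ, ← h1]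
      exact h2
  have htail : ∀ N, cesENorm p I ((∑ n ∈ Finset.range N, u n : Ces p I).1 - S) ≤
      ∑' n, cesENorm p I (u (n + N)).1 := by
    intro N
    refine (cesLint_mono_ae hp.out ?_).trans
      (cesLint_tsum_le hp.out fun n => hFm (n + N))
    filter_upwards [hpart N, hsum, hfin, AEEqFun.coeFn_mk _ hmeas,
      AEEqFun.coeFn_sub (∑ n ∈ Finset.range N, u n : Ces p I).1 S] with t h1 h2 h3 h4 h5
    rw [h5, Pi.sub_apply, h1, hS, h4, ← h2.sum_add_tsum_nat_add N, sub_add_cancel_left, enorm_neg]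
    exact enorm_tsum_le_tsum_enorm
  have hSmem : S ∈ Ces p I := by
    have h0 := htail 0
    have h1 : cesENorm p I ((∑ n ∈ Finset.range 0, u n : Ces p I).1 - S) < ∞ :=
      h0.trans_lt (by simpa using hu'.lt_top)
    have h2 : (∑ n ∈ Finset.range 0, u n : Ces p I).1 - S ∈ Ces p I := h1
    simpa using h2
  refine ⟨⟨S, hSmem⟩, ?_⟩
  rw [tendsto_iff_norm_sub_tendsto_zero]
  have hz : Tendsto (fun N => ∑' n, cesENorm p I (u (n + N)).1) atTop (𝓝 0) :=
    ENNReal.tendsto_sum_nat_add _ hu'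
  have hz2 : Tendsto (fun N => cesENorm p I ((∑ n ∈ Finset.range N, u n : Ces p I).1 - S))
      atTop (𝓝 0) :=
    tendsto_of_tendsto_of_tendsto_of_le_of_le tendsto_const_nhds hz (fun _ => zero_le) htail
  exact (ENNReal.tendsto_toReal ENNReal.zero_ne_top).comp hz2

end Ces

end

/-! The norm of `Ces_p(I)` is the `L^p` norm of the Cesàro mean of `|f|`. Integrating that mean
against `w^(p-1)`, `w = e^{-x}`, and exchanging integrals gives the norm of `f` in a weighted `L¹`
space. So `Ces_p(I)` includes continuously into `L¹` of `cesL1Measure`, a finite measure unless `p =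
1` on the half-line. Szlenk's theorem (`weakBanachSaks_L1`) then yields a subsequence whose means
tend to zero in this weaker norm.

Szlenk's theorem rests on two facts. Weakly null sequences in `L¹` are uniformly integrable, by a
Baire category argument over multipliers bounded by `1`. And bounded sequences in a Hilbert space
have subsequences with Cauchy means; applied in `ℓ²(L²)` to the sequence of all truncations of `f
k`, this handles every truncation level at once.

For `p > 1` the convergence is upgraded by `exists_strictMono_tendsto_lintegral_rpow`. After a
change of density, the Cesàro means form a bounded sequence in `L^p(γ)` whose `L¹(γ)` norms are the
weighted norms above. Subsequence splitting writes it as a `p`-equi-integrable part plus an almost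
disjoint part. Averages of `m` almost disjoint functions have norm of order `m^(1/p - 1)`, which
tends to zero. The equi-integrable part is bounded up to a small error, and for bounded functions
`L¹` convergence forces `L^p` convergence.

For `p = 1` on `[0,1]` the inclusion into `L¹` is isometric, and on the half-line `Ces_1` is zero.
-/

/-- A relation `r` with `r j k` for all large `k` holds along the increasing pairs of a
subsequence. -/
lemma exists_strictMono_forall_lt_rel {r : ℕ → ℕ → Prop} (h : ∀ j, ∀ᶠ k in atTop, r j k) :
    ∃ n : ℕ → ℕ, StrictMono n ∧ ∀ j k, j < k → r (n j) (n k) := by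
  obtain ⟨n, -, hn⟩ := exists_seq_of_forall_finset_exists (fun _ : ℕ => True)
    (fun j k => j < k ∧ r j k) fun s _ => by
      have : ∀ᶠ k in atTop, ∀ j ∈ s, j < k ∧ r j k :=
        (eventually_all_finset s).2 fun j _ => (eventually_gt_atTop j).and (h j)
      obtain ⟨k, hk⟩ := this.exists
      exact ⟨k, trivial, hk⟩
  exact ⟨n, fun j k hjk => (hn j k hjk).1, fun j k hjk => (hn j k hjk).2⟩

/-! ### Banach–Saks in Hilbert space and transfer to Banach spaces -/

section Hilbert

variable {E : Type*} [NormedAddCommGroup E] [InnerProductSpace ℝ E]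

/-- If the Gram matrix of `y` is close to a constant off the diagonal, then so are the inner
products of the arithmetical means. -/
lemma abs_inner_mean_sub_le {y : ℕ → E} {d B : ℝ} {ε : ℕ → ℝ} (hB : 0 ≤ B)
    (h : ∀ i j, |inner ℝ (y i) (y j) - d| ≤ ε i + ε j + if i = j then B else 0)
    {m n : ℕ} (hm : 0 < m) (hn : 0 < n) :
    |inner ℝ ((m : ℝ)⁻¹ • ∑ i ∈ Finset.range m, y i) ((n : ℝ)⁻¹ • ∑ i ∈ Finset.range n, y i) - d| ≤
      (m : ℝ)⁻¹ * ∑ i ∈ Finset.range m, ε i + (n : ℝ)⁻¹ * ∑ i ∈ Finset.range n, ε i +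
        (m : ℝ)⁻¹ * B := by
  have hm' : (0 : ℝ) < m := by exact_mod_cast hm
  have hn' : (0 : ℝ) < n := by exact_mod_cast hn
  have e1 : inner ℝ ((m : ℝ)⁻¹ • ∑ i ∈ Finset.range m, y i)
      ((n : ℝ)⁻¹ • ∑ i ∈ Finset.range n, y i) - d =
      (m : ℝ)⁻¹ * (n : ℝ)⁻¹ *
        ∑ j ∈ Finset.range n, ∑ i ∈ Finset.range m, (inner ℝ (y i) (y j) - d) := by
    rw [real_inner_smul_left, real_inner_smul_right, inner_sum]
    simp_rw [sum_inner, Finset.sum_sub_distrib]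
    simp only [Finset.sum_const, Finset.card_range, nsmul_eq_mul]
    field_simp
  rw [e1, abs_mul, abs_of_pos (by positivity : (0 : ℝ) < (m : ℝ)⁻¹ * (n : ℝ)⁻¹)]
  have e2 : |∑ j ∈ Finset.range n, ∑ i ∈ Finset.range m, (inner ℝ (y i) (y j) - d)| ≤
      ∑ j ∈ Finset.range n, (∑ i ∈ Finset.range m, ε i + m * ε j + B) := by
    refine (Finset.abs_sum_le_sum_abs _ _).trans (Finset.sum_le_sum fun j _ => ?_)
    refine (Finset.abs_sum_le_sum_abs _ _).trans ((Finset.sum_le_sum fun i _ => h i j).trans ?_)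
    rw [Finset.sum_add_distrib, Finset.sum_add_distrib]
    simp only [Finset.sum_const, Finset.card_range, nsmul_eq_mul, Finset.sum_ite_eq']
    gcongr
    -- Row `j` meets the diagonal at most once (not at all if `m ≤ j`), so `B` enters once per row
    -- and is finally divided by `m`.
    split_ifs <;> simp [hB]
  refine (mul_le_mul_of_nonneg_left e2 (by positivity)).trans (le_of_eq ?_)
  rw [Finset.sum_add_distrib, Finset.sum_add_distrib, ← Finset.mul_sum]
  simp only [Finset.sum_const, Finset.card_range, nsmul_eq_mul]
  field_simp

/-- **Banach–Saks theorem** for Hilbert spaces: a bounded sequence has a subsequence whose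
arithmetical means form a Cauchy sequence. -/
theorem exists_strictMono_cauchySeq_mean {x : ℕ → E} {K : ℝ} (hx : ∀ k, ‖x k‖ ≤ K) :
    ∃ n : ℕ → ℕ, StrictMono n ∧
      CauchySeq fun m : ℕ => (m : ℝ)⁻¹ • ∑ i ∈ Finset.range m, x (n i) := by
  have hK : 0 ≤ K := (norm_nonneg _).trans (hx 0)
  have hin : ∀ k j, inner ℝ (x k) (x j) ∈ Icc (-(K * K)) (K * K) := fun k j =>
    abs_le.1 ((abs_real_inner_le_norm _ _).trans
      (mul_le_mul (hx k) (hx j) (norm_nonneg _) hK))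
  -- Compactness is used twice: by Tychonoff the inner products with each fixed `x j` converge to `c
  -- j` along `θ`, and then the numbers `c (θ j)` converge to `d` along `ψ`.
  obtain ⟨c, hc, θ, hθ, hθc⟩ := (isCompact_univ_pi fun _ : ℕ => isCompact_Icc
    (a := -(K * K)) (b := K * K)).tendsto_subseq (x := fun k j => inner ℝ (x k) (x j))
    fun k j _ => hin k j
  obtain ⟨d, hd, ψ, hψ, hψd⟩ := (isCompact_Icc (a := -(K * K)) (b := K * K)).tendsto_subseq
    (x := fun j => c (θ j)) fun j => hc (θ j) trivial
  have hlim : ∀ j, Tendsto (fun k => inner ℝ (x (θ (ψ k))) (x (θ (ψ j)))) atTop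
      (𝓝 (c (θ (ψ j)))) := fun j => ((tendsto_pi_nhds.1 hθc _).comp hψ.tendsto_atTop)
  obtain ⟨n, hn, hnr⟩ := exists_strictMono_forall_lt_rel
    (r := fun j k => |inner ℝ (x (θ (ψ k))) (x (θ (ψ j))) - c (θ (ψ j))| ≤ 1 / ((j : ℝ) + 1))
    fun j => by
      have := (Metric.tendsto_nhds.1 (hlim j)) (1 / ((j : ℝ) + 1)) (by positivity)
      filter_upwards [this] with k hk using hk.le
  refine ⟨fun i => θ (ψ (n i)), hθ.comp (hψ.comp hn), ?_⟩
  set y : ℕ → E := fun i => x (θ (ψ (n i))) with hy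
  set ε : ℕ → ℝ := fun j => 1 / ((n j : ℝ) + 1) + |c (θ (ψ (n j))) - d| with hεdef
  have hε0 : ∀ j, 0 ≤ ε j := fun j => by positivity
  have hεlim : Tendsto ε atTop (𝓝 0) := by
    have h1 : Tendsto (fun j => 1 / ((n j : ℝ) + 1)) atTop (𝓝 0) :=
      tendsto_one_div_add_atTop_nhds_zero_nat.comp hn.tendsto_atTop
    have h2 : Tendsto (fun j => |c (θ (ψ (n j))) - d|) atTop (𝓝 0) := by
      have := (hψd.comp hn.tendsto_atTop).sub_const d
      simpa using this.abs
    have h3 := h1.add h2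
    rwa [add_zero] at h3
  have hlt : ∀ j k, j < k → |inner ℝ (y k) (y j) - d| ≤ ε j := fun j k hjk =>
    (abs_sub_le _ (c (θ (ψ (n j)))) _).trans (add_le_add_left (hnr j k hjk) _)
  have hgram : ∀ i j, |inner ℝ (y i) (y j) - d| ≤
      ε i + ε j + if i = j then 2 * (K * K) else 0 := by
    intro i j
    rcases lt_trichotomy i j with h | h | h
    · rw [if_neg h.ne, real_inner_comm]
      linarith [hlt i j h, hε0 j]
    · rw [if_pos h]
      have h1 := hin (θ (ψ (n i))) (θ (ψ (n j)))
      have : |inner ℝ (y i) (y j) - d| ≤ 2 * (K * K) :=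
        abs_le.2 ⟨by linarith [h1.1, hd.2], by linarith [h1.2, hd.1]⟩
      linarith [hε0 i, hε0 j]
    · rw [if_neg h.ne']
      linarith [hlt j i h, hε0 i]
  set s : ℕ → E := fun m => (m : ℝ)⁻¹ • ∑ i ∈ Finset.range m, y i with hs
  have hces := hεlim.cesaro
  have hinv : Tendsto (fun m : ℕ => (m : ℝ)⁻¹ * (2 * (K * K))) atTop (𝓝 0) := by
    simpa using (tendsto_inv_atTop_nhds_zero_nat (𝕜 := ℝ)).mul_const (2 * (K * K))
  rw [Metric.cauchySeq_iff']
  intro δ hδ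
  -- In `‖s m - s N‖²` the inner products have coefficients `1, -2, 1`, so `d` cancels. Each is
  -- within `3δ²/16` of `d`, for a total error below `12δ²/16`.
  have hδ2 : 0 < δ ^ 2 / 16 := by positivity
  obtain ⟨N, hN⟩ := eventually_atTop.1 (((tendsto_order.1 hces).2 _ hδ2).and
    (((tendsto_order.1 hinv).2 _ hδ2).and (eventually_gt_atTop 0)))
  have key : ∀ a b, N ≤ a → N ≤ b → |inner ℝ (s a) (s b) - d| < 3 * (δ ^ 2 / 16) := by
    intro a b ha hb
    have h1 := hN a ha
    have h2 := hN b hb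
    have := abs_inner_mean_sub_le (by positivity) hgram h1.2.2 h2.2.2
    linarith [h1.1, h1.2.1, h2.1]
  refine ⟨N, fun m hm => ?_⟩
  rw [dist_eq_norm]
  refine lt_of_pow_lt_pow_left₀ 2 hδ.le ?_
  rw [norm_sub_sq_real, ← real_inner_self_eq_norm_sq, ← real_inner_self_eq_norm_sq]
  have h1 := abs_lt.1 (key m m hm hm)
  have h2 := abs_lt.1 (key m N hm le_rfl)
  have h3 := abs_lt.1 (key N N le_rfl le_rfl)
  nlinarith [h1.2, h2.1, h3.2]

/-- A sequence in a Banach space that is approximated, to any precision, by the image of a bounded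
sequence in a Hilbert space under a bounded operator has a subsequence with convergent means. -/
theorem exists_strictMono_tendsto_mean_of_approx {G : Type*} [NormedAddCommGroup G]
    [NormedSpace ℝ G] [CompleteSpace G] {x : ℕ → E} {K : ℝ} (hx : ∀ k, ‖x k‖ ≤ K) {F : ℕ → G}
    (h : ∀ ε > 0, ∃ D : E →L[ℝ] G, ∀ k, ‖D (x k) - F k‖ ≤ ε) :
    ∃ n : ℕ → ℕ, StrictMono n ∧
      ∃ s, Tendsto (fun m : ℕ => (m : ℝ)⁻¹ • ∑ i ∈ Finset.range m, F (n i)) atTop (𝓝 s) := by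
  obtain ⟨n, hn, hc⟩ := exists_strictMono_cauchySeq_mean hx
  refine ⟨n, hn, cauchySeq_tendsto_of_complete ?_⟩
  rw [Metric.cauchySeq_iff']
  intro ε hε
  obtain ⟨D, hD⟩ := h (ε / 4) (by positivity)
  have hc' : CauchySeq fun m : ℕ => (m : ℝ)⁻¹ • ∑ i ∈ Finset.range m, D (x (n i)) := by
    have : CauchySeq fun m : ℕ => D ((m : ℝ)⁻¹ • ∑ i ∈ Finset.range m, x (n i)) :=
      hc.map D.uniformContinuous
    simpa only [map_smul, map_sum] using this
  have hclose : ∀ m : ℕ, ‖(m : ℝ)⁻¹ • ∑ i ∈ Finset.range m, D (x (n i)) -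
      (m : ℝ)⁻¹ • ∑ i ∈ Finset.range m, F (n i)‖ ≤ ε / 4 := by
    intro m
    rw [← smul_sub, ← Finset.sum_sub_distrib, norm_smul, norm_inv, RCLike.norm_natCast]
    calc (m : ℝ)⁻¹ * ‖∑ i ∈ Finset.range m, (D (x (n i)) - F (n i))‖
        ≤ (m : ℝ)⁻¹ * ∑ i ∈ Finset.range m, ε / 4 := by
          gcongr
          exact norm_sum_le_of_le _ fun i _ => hD _
      _ = (m : ℝ)⁻¹ * m * (ε / 4) := by simp [mul_assoc]
      _ ≤ 1 * (ε / 4) := by gcongr; exact inv_mul_le_one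
      _ = ε / 4 := one_mul _
  obtain ⟨N, hN⟩ := (Metric.cauchySeq_iff'.1 hc') (ε / 4) (by positivity)
  refine ⟨N, fun m hm => ?_⟩
  have h1 := hN m hm
  have h2 := hclose m
  have h3 := hclose N
  rw [← dist_eq_norm] at h2 h3
  rw [dist_comm] at h2
  linarith [dist_triangle4 ((m : ℝ)⁻¹ • ∑ i ∈ Finset.range m, F (n i))
    ((m : ℝ)⁻¹ • ∑ i ∈ Finset.range m, D (x (n i)))
    ((N : ℝ)⁻¹ • ∑ i ∈ Finset.range N, D (x (n i)))
    ((N : ℝ)⁻¹ • ∑ i ∈ Finset.range N, F (n i))]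

end Hilbert

/-- Weakly null sequences are bounded. -/
lemma exists_norm_le_of_weakly_null {E : Type*} [NormedAddCommGroup E] [NormedSpace ℝ E]
    {x : ℕ → E} (hx : ∀ φ : StrongDual ℝ E, Tendsto (fun n => φ (x n)) atTop (𝓝 0)) :
    ∃ C : ℝ, ∀ n, ‖x n‖ ≤ C := by
  obtain ⟨C, hC⟩ := banach_steinhaus (g := fun n => NormedSpace.inclusionInDoubleDual ℝ E (x n))
    fun φ => by
      obtain ⟨B, hB⟩ := (hx φ).norm.bddAbove_range
      exact ⟨B, fun n => hB ⟨n, rfl⟩⟩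
  refine ⟨C, fun n => ?_⟩
  have := (NormedSpace.inclusionInDoubleDualLi (E := E) ℝ).norm_map (x n)
  rw [← this]
  exact hC n

/-! ### Uniform integrability of weakly null sequences in `L¹` -/

section L1

variable {α : Type*} [MeasurableSpace α] {μ : Measure α}

/-- A measurable sign turns pairings with bounded functions into `L¹` norms. -/
lemma exists_measurable_mul_eq_abs :
    ∃ s : ℝ → ℝ, Measurable s ∧ (∀ y, |s y| ≤ 1) ∧ ∀ y, y * s y = |y| := by
  refine ⟨fun y => if 0 ≤ y then 1 else -1,
    Measurable.ite measurableSet_Ici measurable_const measurable_const, fun y => ?_, fun y => ?_⟩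
  · dsimp only
    split_ifs <;> simp
  · dsimp only
    split_ifs with h
    · rw [abs_of_nonneg h, mul_one]
    · rw [abs_of_neg (not_le.1 h), mul_neg_one]

lemma integrable_L1_mul (f : Lp ℝ 1 μ) {φ : α → ℝ} (hφ : AEStronglyMeasurable φ μ)
    (hb : ∀ᵐ x ∂μ, |φ x| ≤ 1) : Integrable (fun x => f x * φ x) μ :=
  (L1.integrable_coeFn f).mul_bdd hφ hb

/-- The functional on `L¹` given by integration against a function bounded by `1`. -/
noncomputable def l1Pairing (φ : α → ℝ) (hφ : AEStronglyMeasurable φ μ) (hb : ∀ᵐ x ∂μ, |φ x| ≤ 1) :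
    StrongDual ℝ (Lp ℝ 1 μ) :=
  LinearMap.mkContinuous
    { toFun := fun f => ∫ x, f x * φ x ∂μ
      map_add' := fun f g => by
        rw [← integral_add (integrable_L1_mul f hφ hb) (integrable_L1_mul g hφ hb)]
        refine integral_congr_ae ?_
        filter_upwards [Lp.coeFn_add f g] with x hx
        rw [hx, Pi.add_apply, add_mul]
      map_smul' := fun c f => by
        rw [RingHom.id_apply, smul_eq_mul, ← integral_const_mul]
        refine integral_congr_ae ?_
        filter_upwards [Lp.coeFn_smul c f] with x hx
        rw [hx, Pi.smul_apply, smul_eq_mul, mul_assoc] } 1 fun f => by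
    rw [one_mul, L1.norm_eq_integral_norm]
    refine norm_integral_le_of_norm_le (L1.integrable_coeFn f).norm ?_
    filter_upwards [hb] with x hx
    rw [norm_mul]
    exact mul_le_of_le_one_right (norm_nonneg _) hx

lemma l1Pairing_apply {φ : α → ℝ} (hφ : AEStronglyMeasurable φ μ) (hb : ∀ᵐ x ∂μ, |φ x| ≤ 1)
    (f : Lp ℝ 1 μ) : l1Pairing φ hφ hb f = ∫ x, f x * φ x ∂μ := rfl

lemma exists_seq_tendsto_ae_of_tendsto_L1 {u : ℕ → Lp ℝ 1 μ} {v : Lp ℝ 1 μ}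
    (h : Tendsto u atTop (𝓝 v)) :
    ∃ ns : ℕ → ℕ, StrictMono ns ∧ ∀ᵐ x ∂μ, Tendsto (fun i => u (ns i) x) atTop (𝓝 (v x)) :=
  (tendstoInMeasure_of_tendsto_eLpNorm one_ne_zero (fun n => Lp.aestronglyMeasurable (u n))
    (Lp.aestronglyMeasurable v) ((Lp.tendsto_Lp_iff_tendsto_eLpNorm' u v).1 h)).exists_seq_tendsto_ae

/-- The functions in `L¹` that are bounded by `1`. -/
def l1UnitBounded (μ : Measure α) : Set (Lp ℝ 1 μ) := {φ | ∀ᵐ x ∂μ, |φ x| ≤ 1}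

/-- The bound passes to the limit along an a.e. convergent subsequence. Closedness makes this set a
complete metric space, to which Baire's theorem applies. -/
lemma isClosed_l1UnitBounded : IsClosed (l1UnitBounded μ) := by
  refine IsSeqClosed.isClosed fun u v hu huv => ?_
  obtain ⟨ns, -, hns⟩ := exists_seq_tendsto_ae_of_tendsto_L1 huv
  have hall : ∀ᵐ x ∂μ, ∀ n, |u n x| ≤ 1 := ae_all_iff.2 hu
  filter_upwards [hns, hall] with x h1 h2
  exact le_of_tendsto h1.abs (Eventually.of_forall fun i => h2 _)

/-- For a general `f` in `L¹`, pairing is not continuous in the `L¹` distance of the multipliers. On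
multipliers bounded by `1` it is, by dominated convergence with majorant `|f|` along a.e. convergent
sub-subsequences. -/
lemma continuous_integral_mul_l1UnitBounded (f : Lp ℝ 1 μ) :
    Continuous fun φ : l1UnitBounded μ => ∫ x, f x * φ.1 x ∂μ := by
  refine SeqContinuous.continuous fun u v huv => ?_
  refine tendsto_of_subseq_tendsto fun ns hns => ?_
  have huv' : Tendsto (fun i => (u (ns i)).1) atTop (𝓝 v.1) :=
    ((continuous_subtype_val.tendsto v).comp huv).comp hns
  obtain ⟨ms, -, hms⟩ := exists_seq_tendsto_ae_of_tendsto_L1 huv'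
  refine ⟨ms, tendsto_integral_of_dominated_convergence (fun x => ‖f x‖)
    (fun i => (Lp.aestronglyMeasurable f).mul (Lp.aestronglyMeasurable _))
    (L1.integrable_coeFn f).norm (fun i => ?_) ?_⟩
  · filter_upwards [(u (ns (ms i))).2] with x hx
    rw [norm_mul]
    exact mul_le_of_le_one_right (norm_nonneg _) hx
  · filter_upwards [hms] with x hx
    exact hx.const_mul _

/-- A weakly null sequence in `L¹` of a finite measure is uniformly integrable. -/
theorem unifIntegrable_of_weakly_null [IsFiniteMeasure μ] {f : ℕ → Lp ℝ 1 μ}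
    (hf : ∀ φ : StrongDual ℝ (Lp ℝ 1 μ), Tendsto (fun n => φ (f n)) atTop (𝓝 0)) :
    UnifIntegrable (fun k => (f k : α → ℝ)) 1 μ := by
  intro ε hε
  have : CompleteSpace (l1UnitBounded μ) := isClosed_l1UnitBounded.completeSpace_coe
  have : Nonempty (l1UnitBounded μ) := ⟨⟨0, by
    filter_upwards [Lp.coeFn_zero ℝ 1 μ] with x hx
    rw [hx]
    simp⟩⟩
  -- Weak nullity says that these closed sets cover the space, so by Baire one of them contains a
  -- ball.
  set F : ℕ → Set (l1UnitBounded μ) :=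
    fun N => ⋂ k ≥ N, {φ | |∫ x, f k x * φ.1 x ∂μ| ≤ ε / 2} with hF
  obtain ⟨N, φ₀, hφ₀⟩ := nonempty_interior_of_iUnion_of_closed (f := F)
    (fun N => isClosed_biInter fun k _ =>
      isClosed_le (continuous_integral_mul_l1UnitBounded (f k)).abs continuous_const)
    (by
      refine eq_univ_of_forall fun φ => ?_
      have h1 := (hf (l1Pairing φ.1 (Lp.aestronglyMeasurable _) φ.2)).abs
      rw [abs_zero] at h1
      obtain ⟨N, hN⟩ := eventually_atTop.1 ((tendsto_order.1 h1).2 (ε / 2) (by positivity))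
      exact mem_iUnion.2 ⟨N, mem_iInter₂.2 fun k hk => (hN k hk).le⟩)
  obtain ⟨r, hr, hball⟩ := Metric.isOpen_iff.1 isOpen_interior φ₀ hφ₀
  -- Redefining `φ₀` on `A` moves it by at most `2 μ(A) ≤ r / 2` in `L¹`, hence not out of the ball.
  have hswap : ∀ k ≥ N, ∀ A, MeasurableSet A → μ A ≤ ENNReal.ofReal (r / 4) → ∀ θ : α → ℝ,
      AEStronglyMeasurable θ μ → (∀ x, |θ x| ≤ 1) →
      |∫ x, f k x * (A.indicator θ x + Aᶜ.indicator φ₀.1 x) ∂μ| ≤ ε / 2 := by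
    intro k hk A hA hμA θ hθ hθb
    set ψ : α → ℝ := fun x => A.indicator θ x + Aᶜ.indicator φ₀.1 x with hψ
    have hψm : AEStronglyMeasurable ψ μ :=
      (hθ.indicator hA).add ((Lp.aestronglyMeasurable _).indicator hA.compl)
    have hψb : ∀ᵐ x ∂μ, |ψ x| ≤ 1 := by
      filter_upwards [φ₀.2] with x hx
      by_cases hxA : x ∈ A <;> simp [hψ, hxA, hx, hθb x]
    have hψL : MemLp ψ 1 μ := MemLp.of_bound hψm 1 hψb
    have hψU : hψL.toLp ψ ∈ l1UnitBounded μ := by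
      filter_upwards [hψL.coeFn_toLp, hψb] with x h1 h2
      rwa [h1]
    have hdist : dist (⟨hψL.toLp ψ, hψU⟩ : l1UnitBounded μ) φ₀ < r := by
      rw [Subtype.dist_eq, Lp.dist_def]
      have h1 : eLpNorm (⇑(hψL.toLp ψ) - ⇑φ₀.1) 1 μ ≤ ENNReal.ofReal (r / 2) := by
        calc eLpNorm (⇑(hψL.toLp ψ) - ⇑φ₀.1) 1 μ
            ≤ eLpNorm (A.indicator fun _ => (2 : ℝ)) 1 μ := by
              refine eLpNorm_mono_ae ?_
              filter_upwards [hψL.coeFn_toLp, φ₀.2] with x h1 h2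
              rw [Pi.sub_apply, h1]
              by_cases hxA : x ∈ A
              · simp only [hψ, hxA, indicator_of_mem, mem_compl_iff, not_true_eq_false,
                  not_false_eq_true, indicator_of_notMem, add_zero, Real.norm_eq_abs, abs_two]
                exact (abs_sub _ _).trans (by linarith [hθb x])
              · simp [hψ, hxA]
          _ = 2 * μ A := by
              rw [eLpNorm_indicator_const hA one_ne_zero ENNReal.one_ne_top]
              simp [enorm_eq_nnnorm]
          _ ≤ 2 * ENNReal.ofReal (r / 4) := by gcongr
          _ = ENNReal.ofReal (r / 2) := by
              rw [← ENNReal.ofReal_ofNat, ← ENNReal.ofReal_mul (by norm_num)]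
              congr 1
              ring
      refine lt_of_le_of_lt (ENNReal.toReal_le_of_le_ofReal (by positivity) h1) (by linarith)
    have h1 := mem_iInter₂.1 (interior_subset (hball hdist)) k hk
    have h2 : ∫ x, f k x * (hψL.toLp ψ : α → ℝ) x ∂μ = ∫ x, f k x * ψ x ∂μ := by
      refine integral_congr_ae ?_
      filter_upwards [hψL.coeFn_toLp] with x h1
      rw [h1]
    rw [← h2]
    exact h1
  obtain ⟨s, hsm, hsb, hsabs⟩ := exists_measurable_mul_eq_abs
  have hlarge : ∀ k ≥ N, ∀ A, MeasurableSet A → μ A ≤ ENNReal.ofReal (r / 4) →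
      eLpNorm (A.indicator (f k)) 1 μ ≤ ENNReal.ofReal ε := by
    intro k hk A hA hμA
    have hsf : AEStronglyMeasurable (fun x => s (f k x)) μ :=
      (hsm.comp_aemeasurable (Lp.aestronglyMeasurable (f k)).aemeasurable).aestronglyMeasurable
    -- The two choices `θ = sign (f k)` and `θ = 0` agree off `A`; their pairings differ by exactly
    -- `∫_A |f k|`, which is thus at most `ε / 2 + ε / 2`.
    have h1 := hswap k hk A hA hμA _ hsf fun x => hsb _
    have h2 := hswap k hk A hA hμA (fun _ => 0) aestronglyMeasurable_const (by simp)
    have hint : ∀ θ : α → ℝ, AEStronglyMeasurable θ μ → (∀ x, |θ x| ≤ 1) →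
        Integrable (fun x => f k x * (A.indicator θ x + Aᶜ.indicator φ₀.1 x)) μ := by
      intro θ hθ hθb
      refine integrable_L1_mul _
        ((hθ.indicator hA).add ((Lp.aestronglyMeasurable _).indicator hA.compl)) ?_
      filter_upwards [φ₀.2] with x hx
      by_cases hxA : x ∈ A <;> simp [hxA, hx, hθb x]
    have h3 : ∫ x, ‖A.indicator (f k) x‖ ∂μ =
        ∫ x, f k x * (A.indicator (fun x => s (f k x)) x + Aᶜ.indicator φ₀.1 x) ∂μ -
        ∫ x, f k x * (A.indicator (fun _ => 0) x + Aᶜ.indicator φ₀.1 x) ∂μ := by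
      rw [← integral_sub (hint _ hsf fun x => hsb _)
        (hint _ aestronglyMeasurable_const (by simp))]
      congr 1
      ext x
      by_cases hxA : x ∈ A <;> simp [hxA, hsabs]
    rw [eLpNorm_one_eq_lintegral_enorm,
      ← ofReal_integral_norm_eq_lintegral_enorm ((L1.integrable_coeFn (f k)).indicator hA), h3]
    refine ENNReal.ofReal_le_ofReal ?_
    linarith [(abs_le.1 h1).2, (abs_le.1 h2).1]
  obtain ⟨δ, hδ, hsmall⟩ := unifIntegrable_fin (n := N) (f := fun k => (f k : α → ℝ)) le_rfl
    ENNReal.one_ne_top (fun k => Lp.memLp (f k)) hε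
  refine ⟨min δ (r / 4), lt_min hδ (by positivity), fun k A hA hμA => ?_⟩
  rcases lt_or_ge k N with hk | hk
  · exact hsmall ⟨k, hk⟩ A hA (hμA.trans (ENNReal.ofReal_le_ofReal (min_le_left _ _)))
  · exact hlarge k hk A hA (hμA.trans (ENNReal.ofReal_le_ofReal (min_le_right _ _)))

end L1

/-! ### Szlenk's theorem for finite measures -/

section Szlenk

variable {α : Type*} [MeasurableSpace α] {μ : Measure α}

/-- The inclusion of `L²` into `L¹` for a finite measure. -/
noncomputable def l2ToL1 (μ : Measure α) [IsFiniteMeasure μ] : Lp ℝ 2 μ →L[ℝ] Lp ℝ 1 μ :=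
  LinearMap.mkContinuous
    { toFun := fun f => ⟨f.1, Lp.antitone one_le_two f.2⟩
      map_add' := fun _ _ => rfl
      map_smul' := fun _ _ => rfl } ((μ univ) ^ (1 / (1 : ℝ) - 1 / (2 : ℝ))).toReal fun f => by
    rw [Lp.norm_def, Lp.norm_def, mul_comm, ← ENNReal.toReal_mul]
    refine ENNReal.toReal_mono (ENNReal.mul_ne_top (Lp.eLpNorm_ne_top f)
      (ENNReal.rpow_ne_top_of_nonneg (by norm_num) (measure_ne_top _ _))) ?_
    have := eLpNorm_le_eLpNorm_mul_rpow_measure_univ (μ := μ) (p := 1) (q := 2) one_le_two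
      (Lp.aestronglyMeasurable f)
    simpa using this

lemma coeFn_l2ToL1 [IsFiniteMeasure μ] (f : Lp ℝ 2 μ) : (l2ToL1 μ f : α → ℝ) = f := rfl

/-- The function on the line that is the identity on `(-M, M)` and vanishes elsewhere. -/
noncomputable def cutoff (M : ℝ) (y : ℝ) : ℝ := if |y| < M then y else 0

lemma measurable_cutoff (M : ℝ) : Measurable (cutoff M) :=
  Measurable.ite (measurableSet_lt measurable_norm measurable_const) measurable_id measurable_const

lemma abs_cutoff_le {M : ℝ} (hM : 0 ≤ M) (y : ℝ) : |cutoff M y| ≤ M := by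
  unfold cutoff
  split_ifs with h
  · exact h.le
  · simpa using hM

lemma memLp_cutoff [IsFiniteMeasure μ] {f : α → ℝ} (hf : AEStronglyMeasurable f μ) {M : ℝ}
    (hM : 0 ≤ M) (q : ℝ≥0∞) : MemLp (fun x => cutoff M (f x)) q μ :=
  MemLp.of_bound ((measurable_cutoff M).comp_aemeasurable hf.aemeasurable).aestronglyMeasurable M
    (ae_of_all _ fun _ => abs_cutoff_le hM _)

/-- **Szlenk's theorem**: `L¹` of a finite measure has the weak Banach–Saks property. -/
theorem weakBanachSaks_L1 (μ : Measure α) [IsFiniteMeasure μ] : WeakBanachSaks (Lp ℝ 1 μ) := by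
  intro f hf
  have hui : UniformIntegrable (fun k => (f k : α → ℝ)) 1 μ := by
    obtain ⟨C, hC⟩ := exists_norm_le_of_weakly_null hf
    refine ⟨fun k => Lp.aestronglyMeasurable _, unifIntegrable_of_weakly_null hf, C.toNNReal,
      fun k => ?_⟩
    have := ENNReal.ofReal_le_ofReal (hC k)
    rwa [Lp.norm_def, ENNReal.ofReal_toReal (Lp.eLpNorm_ne_top _)] at this
  have hmem : ∀ k (M : ℕ), MemLp (fun x => cutoff M (f k x)) 2 μ := fun k M =>
    memLp_cutoff (Lp.aestronglyMeasurable _) M.cast_nonneg 2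
  set B : ℝ := (measureUnivNNReal μ : ℝ) ^ (2 : ℝ≥0∞).toReal⁻¹ with hB
  have hB0 : 0 ≤ B := by positivity
  -- The truncation at height `M` has `L²` norm at most `B * M`. The weight reduces this to `2^(-M)
  -- * B`, which is square summable in `M`, uniformly in `k`. The `+ 1` covers `M = 0`.
  set c : ℕ → ℝ := fun M => (1 / 2) ^ M / (M + 1) with hc
  have hc0 : ∀ M, 0 < c M := fun M => by positivity
  have hcoord : ∀ k M, ‖c M • (hmem k M).toLp _‖ ≤ (1 / 2) ^ M * B := by
    intro k M
    have h1 : ‖(hmem k M).toLp _‖ ≤ B * M := by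
      refine Lp.norm_le_of_ae_bound M.cast_nonneg ?_
      filter_upwards [(hmem k M).coeFn_toLp] with x hx
      rw [hx]
      exact abs_cutoff_le M.cast_nonneg _
    rw [norm_smul, Real.norm_of_nonneg (hc0 M).le]
    calc c M * ‖(hmem k M).toLp _‖ ≤ c M * (B * M) := by gcongr
      _ ≤ c M * (B * (M + 1)) := by gcongr; linarith
      _ = (1 / 2) ^ M * B := by simp only [hc]; field_simp
  have hsq : ∀ k M, ‖c M • (hmem k M).toLp _‖ ^ (2 : ℝ≥0∞).toReal ≤ (1 / 4) ^ M * B ^ 2 := by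
    intro k M
    rw [ENNReal.toReal_ofNat, Real.rpow_two]
    refine (pow_le_pow_left₀ (norm_nonneg _) (hcoord k M) 2).trans (le_of_eq ?_)
    rw [mul_pow, ← pow_mul, mul_comm M 2, pow_mul]
    norm_num
  have hgeom : Summable fun M : ℕ => (1 / 4 : ℝ) ^ M * B ^ 2 :=
    (summable_geometric_of_lt_one (by norm_num) (by norm_num)).mul_right _
  have hsum : ∀ k, Summable fun M => ‖c M • (hmem k M).toLp _‖ ^ (2 : ℝ≥0∞).toReal := fun k =>
    Summable.of_nonneg_of_le (fun M => by positivity) (hsq k) hgeom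
  set x : ℕ → lp (fun _ : ℕ => Lp ℝ 2 μ) 2 := fun k =>
    ⟨fun M => c M • (hmem k M).toLp _, memℓp_gen (hsum k)⟩ with hx
  have hxb : ∀ k, ‖x k‖ ≤ √(∑' M : ℕ, (1 / 4 : ℝ) ^ M * B ^ 2) := by
    intro k
    refine lp.norm_le_of_tsum_le (by simp) (by positivity) ?_
    rw [ENNReal.toReal_ofNat, Real.rpow_two, Real.sq_sqrt (tsum_nonneg fun M => by positivity)]
    have := (hsum k).tsum_le_tsum (hsq k) hgeom
    simpa using this
  obtain ⟨n, hn, s, hs⟩ := exists_strictMono_tendsto_mean_of_approx hxb (F := f) (by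
    intro ε hε
    obtain ⟨C, hC⟩ := hui.spec one_ne_zero ENNReal.one_ne_top hε
    obtain ⟨M, hM⟩ := exists_nat_ge (C : ℝ)
    -- Reading off coordinate `M` and undoing the weight recovers the truncation. It differs from `f
    -- k` only where `|f k| ≥ M ≥ C`, and that part is small in `L¹` by uniform integrability.
    refine ⟨(c M)⁻¹ • (l2ToL1 μ).comp (lp.evalCLM ℝ (fun _ : ℕ => Lp ℝ 2 μ) 2 M), fun k => ?_⟩
    have h1 : ((c M)⁻¹ • (l2ToL1 μ).comp (lp.evalCLM ℝ (fun _ : ℕ => Lp ℝ 2 μ) 2 M)) (x k) =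
        l2ToL1 μ ((hmem k M).toLp _) := by
      have : lp.evalCLM ℝ (fun _ : ℕ => Lp ℝ 2 μ) 2 M (x k) = c M • (hmem k M).toLp _ := rfl
      rw [_root_.smul_apply, ContinuousLinearMap.comp_apply, this, map_smul,
        smul_smul, inv_mul_cancel₀ (hc0 M).ne', one_smul]
    rw [h1, Lp.norm_def]
    refine ENNReal.toReal_le_of_le_ofReal hε.le ((eLpNorm_mono_ae ?_).trans (hC k))
    filter_upwards [Lp.coeFn_sub (l2ToL1 μ ((hmem k M).toLp _)) (f k), (hmem k M).coeFn_toLp]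
      with y h2 h3
    rw [h2, Pi.sub_apply, coeFn_l2ToL1, h3]
    unfold cutoff
    split_ifs with h4
    · simp
    · have h5 : y ∈ {y | C ≤ ‖f k y‖₊} := by
        have : (C : ℝ) ≤ ‖f k y‖ := hM.trans (not_lt.1 h4)
        exact_mod_cast this
      rw [indicator_of_mem h5]
      simp)
  obtain ⟨sg, hsm, hsb, hsabs⟩ := exists_measurable_mul_eq_abs
  -- The truncations need not be weakly null, so the Hilbert space argument does not identify the
  -- limit. Pairing with the sign of `s` gives `‖s‖` in the limit, while weak nullity of `f` gives
  -- `0`.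
  have hs0 : s = 0 := by
    set φ := l1Pairing (μ := μ) (fun y => sg (s y))
      (hsm.comp_aemeasurable (Lp.aestronglyMeasurable s).aemeasurable).aestronglyMeasurable
      (ae_of_all _ fun _ => hsb _) with hφ
    have h1 : Tendsto (fun m : ℕ => φ ((m : ℝ)⁻¹ • ∑ i ∈ Finset.range m, f (n i))) atTop
        (𝓝 (φ s)) := (φ.continuous.tendsto s).comp hs
    have h2 : Tendsto (fun m : ℕ => φ ((m : ℝ)⁻¹ • ∑ i ∈ Finset.range m, f (n i))) atTop
        (𝓝 0) := by
      have : Tendsto (fun k => φ (f (n k))) atTop (𝓝 0) := (hf φ).comp hn.tendsto_atTop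
      have := this.cesaro
      simpa only [map_smul, map_sum, smul_eq_mul] using this
    have h3 := tendsto_nhds_unique h1 h2
    rw [hφ, l1Pairing_apply] at h3
    simp_rw [hsabs] at h3
    rw [← norm_eq_zero, L1.norm_eq_integral_norm]
    exact h3
  refine ⟨n, hn, ?_⟩
  have := hs.norm
  rw [hs0, norm_zero] at this
  refine this.congr fun m => ?_
  rw [norm_smul, norm_inv, RCLike.norm_natCast, one_div]

end Szlenk

/-! ### Subsequence splitting in `L^p` -/

section PowerSplitting

variable {α : Type*} [MeasurableSpace α] {γ : Measure α} {p : ℝ}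

/-- The `L^p` norm of a function with values in `[0, ∞]`. -/
noncomputable def lintegralLpNorm (p : ℝ) (γ : Measure α) (h : α → ℝ≥0∞) : ℝ≥0∞ :=
  (∫⁻ x, h x ^ p ∂γ) ^ (1 / p)

lemma lintegralLpNorm_mono (hp : 0 < p) {f g : α → ℝ≥0∞} (h : ∀ x, f x ≤ g x) :
    lintegralLpNorm p γ f ≤ lintegralLpNorm p γ g :=
  ENNReal.rpow_le_rpow (lintegral_mono fun x => ENNReal.rpow_le_rpow (h x) hp.le) (by positivity)

lemma lintegralLpNorm_le_iff (hp : 0 < p) {f : α → ℝ≥0∞} {c : ℝ≥0∞} :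
    lintegralLpNorm p γ f ≤ c ↔ ∫⁻ x, f x ^ p ∂γ ≤ c ^ p := by
  rw [lintegralLpNorm, one_div, ENNReal.rpow_inv_le_iff hp]

lemma lintegralLpNorm_rpow (hp : 0 < p) (f : α → ℝ≥0∞) :
    lintegralLpNorm p γ f ^ p = ∫⁻ x, f x ^ p ∂γ := by
  rw [lintegralLpNorm, one_div, ENNReal.rpow_inv_rpow hp.ne']

lemma lintegralLpNorm_add_le (hp : 1 ≤ p) {f g : α → ℝ≥0∞} (hf : Measurable f)
    (hg : Measurable g) : lintegralLpNorm p γ (fun x => f x + g x) ≤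
      lintegralLpNorm p γ f + lintegralLpNorm p γ g :=
  ENNReal.lintegral_Lp_add_le hf.aemeasurable hg.aemeasurable hp

lemma lintegralLpNorm_sum_le (hp : 1 ≤ p) {f : ℕ → α → ℝ≥0∞} (hf : ∀ k, Measurable (f k))
    (m : ℕ) : lintegralLpNorm p γ (fun x => ∑ k ∈ Finset.range m, f k x) ≤
      ∑ k ∈ Finset.range m, lintegralLpNorm p γ (f k) := by
  have hp0 : 0 < p := by linarith
  induction m with
  | zero => simp [lintegralLpNorm, hp0]
  | succ m ih =>
    simp_rw [Finset.sum_range_succ]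
    exact (lintegralLpNorm_add_le hp (Finset.measurable_fun_sum _ fun k _ => hf k) (hf m)).trans
      (add_le_add_left ih _)

lemma lintegralLpNorm_const_mul (hp : 0 < p) {f : α → ℝ≥0∞} (hf : Measurable f) (c : ℝ≥0∞) :
    lintegralLpNorm p γ (fun x => c * f x) = c * lintegralLpNorm p γ f := by
  unfold lintegralLpNorm
  simp_rw [ENNReal.mul_rpow_of_nonneg _ _ hp.le]
  rw [lintegral_const_mul _ (hf.pow_const p), ENNReal.mul_rpow_of_nonneg _ _ (by positivity),
    ← ENNReal.rpow_mul, mul_one_div_cancel hp.ne', ENNReal.rpow_one]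

/-- Markov's inequality for `h ^ p`; since `M ≥ 1`, `h ≤ h ^ p` on the set in question. -/
lemma measure_natCast_lt_le (hp : 1 ≤ p) {h : α → ℝ≥0∞} (hh : Measurable h) {K : ℝ≥0∞}
    (hK : ∫⁻ x, h x ^ p ∂γ ≤ K) {M : ℕ} (hM : 1 ≤ M) : γ {x | (M : ℝ≥0∞) < h x} ≤ K / M := by
  have hM' : (1 : ℝ≥0∞) ≤ M := by exact_mod_cast hM
  rw [ENNReal.le_div_iff_mul_le (Or.inl (by positivity)) (Or.inl (ENNReal.natCast_ne_top M)),
    mul_comm]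
  refine le_trans ?_ ((mul_meas_ge_le_lintegral (hh.pow_const p) (M : ℝ≥0∞)).trans hK)
  gcongr with x
  intro hx
  have : h x ^ (1 : ℝ) ≤ h x ^ p := ENNReal.rpow_le_rpow_of_exponent_le (hM'.trans hx.le) hp
  rw [ENNReal.rpow_one] at this
  exact hx.le.trans this

lemma tendsto_div_natCast {K : ℝ≥0∞} (hK : K ≠ ∞) :
    Tendsto (fun M : ℕ => K / (M : ℝ≥0∞)) atTop (𝓝 0) := by
  simpa [div_eq_mul_inv] using
    ENNReal.Tendsto.const_mul ENNReal.tendsto_inv_nat_nhds_zero (Or.inr hK)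

/-- Subsequence splitting: along a subsequence, a bounded sequence in `L^p` is `p`-equi-integrable
off sets `E k` whose measure tends to zero. -/
lemma exists_strictMono_equiintegrable_off (hp : 1 ≤ p) {H : ℕ → α → ℝ≥0∞}
    (hH : ∀ k, Measurable (H k)) {K : ℝ≥0∞} (hK : K ≠ ∞) (hHK : ∀ k, ∫⁻ x, H k x ^ p ∂γ ≤ K) :
    ∃ n : ℕ → ℕ, StrictMono n ∧ ∃ E : ℕ → Set α, (∀ k, MeasurableSet (E k)) ∧
      Tendsto (fun k => γ (E k)) atTop (𝓝 0) ∧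
      ∀ ε : ℝ≥0∞, ε ≠ 0 → ∃ M : ℕ, ∀ k,
        ∫⁻ x in (E k)ᶜ ∩ {x | (M : ℝ≥0∞) < H (n k) x}, H (n k) x ^ p ∂γ ≤ ε := by
  have hset : ∀ k (M : ℕ), MeasurableSet {x | (M : ℝ≥0∞) < H k x} := fun k M =>
    measurableSet_lt measurable_const (hH k)
  set J : ℕ → ℕ → ℝ≥0∞ := fun k M => ∫⁻ x in {x | (M : ℝ≥0∞) < H k x}, H k x ^ p ∂γ with hJ
  have hJanti : ∀ k, Antitone (J k) := fun k M M' h =>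
    lintegral_mono_set fun x (hx : (M' : ℝ≥0∞) < H k x) =>
      lt_of_le_of_lt (by exact_mod_cast h) hx
  have hJK : ∀ k M, J k M ≤ K := fun k M => (setLIntegral_le_lintegral _ _).trans (hHK k)
  -- Compactness of `[0,∞]^ℕ` makes the tail masses converge at all heights `M` simultaneously.
  obtain ⟨J', θ, hθ, hJ'⟩ := CompactSpace.tendsto_subseq J
  have hlim : ∀ M, Tendsto (fun k => J (θ k) M) atTop (𝓝 (J' M)) := tendsto_pi_nhds.1 hJ'
  have hJ'K : ∀ M, J' M ≤ K := fun M => le_of_tendsto' (hlim M) fun k => hJK _ _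
  -- The `N`-th chosen function still carries, above height `N`, nearly the limiting mass `J' N`.
  -- The set removed from it will be the part above that height.
  obtain ⟨ψ, hψ, hψJ⟩ := extraction_forall_of_eventually
    (P := fun N k => J' N < J (θ k) N + ((N : ℝ≥0∞) + 1)⁻¹) fun N => by
      refine ((hlim N).add_const ((N : ℝ≥0∞) + 1)⁻¹).eventually_const_lt ?_
      exact ENNReal.lt_add_right (ne_top_of_le_ne_top hK (hJ'K N))
        (by simp)
  set n : ℕ → ℕ := fun k => θ (ψ k) with hn
  refine ⟨n, hθ.comp hψ, fun k => {x | (k : ℝ≥0∞) < H (n k) x}, fun k => hset _ _, ?_, ?_⟩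
  · refine tendsto_of_tendsto_of_tendsto_of_le_of_le' tendsto_const_nhds (tendsto_div_natCast hK)
      (Eventually.of_forall fun _ => zero_le) ?_
    filter_upwards [eventually_ge_atTop 1] with k hk
    exact measure_natCast_lt_le hp (hH _) (hHK _) hk
  intro ε hε
  -- `L` is the mass escaping to infinite height. The removed parts carry at least nearly `L`, while
  -- the total mass above a large `M₀` is at most slightly more than `L`, so little is left in
  -- between.
  set L := ⨅ M, J' M with hL
  have hLtop : L ≠ ∞ := ne_top_of_le_ne_top hK ((iInf_le _ 0).trans (hJ'K 0))
  have hε3 : ε / 3 ≠ 0 := (ENNReal.div_pos hε (by norm_num)).ne'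
  obtain ⟨M₀, hM₀⟩ := iInf_lt_iff.1 (ENNReal.lt_add_right hLtop hε3)
  have hev : ∀ᶠ k in atTop, J (n k) M₀ < L + ε / 3 + ε / 3 ∧ ((k : ℝ≥0∞) + 1)⁻¹ < ε / 3 ∧
      M₀ ≤ k := by
    refine Eventually.and ?_ (Eventually.and ?_ (eventually_ge_atTop _))
    · have h1 := (hlim M₀).comp hψ.tendsto_atTop
      exact h1.eventually_lt_const (hM₀.trans_le le_self_add)
    · have h1 : Tendsto (fun k : ℕ => ((k + 1 : ℕ) : ℝ≥0∞)⁻¹) atTop (𝓝 0) :=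
        ENNReal.tendsto_inv_nat_nhds_zero.comp (tendsto_add_atTop_nat 1)
      have h2 := h1.eventually_lt_const (pos_iff_ne_zero.2 hε3)
      simpa using h2
  obtain ⟨k₀, hk₀⟩ := eventually_atTop.1 hev
  -- The finitely many indices below `k₀` are handled by absolute continuity of each integral.
  have hfin : ∀ᶠ M in atTop, ∀ k ∈ Finset.range k₀, J (n k) M ≤ ε := by
    refine (eventually_all_finset _).2 fun k _ => ?_
    have h1 : Tendsto (fun M : ℕ => γ {x | (M : ℝ≥0∞) < H (n k) x}) atTop (𝓝 0) := by
      refine tendsto_of_tendsto_of_tendsto_of_le_of_le' tendsto_const_nhds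
        (tendsto_div_natCast hK) (Eventually.of_forall fun _ => zero_le) ?_
      filter_upwards [eventually_ge_atTop 1] with M hM
      exact measure_natCast_lt_le hp (hH _) (hHK _) hM
    have h2 := tendsto_setLIntegral_zero (ne_top_of_le_ne_top hK (hHK (n k))) h1
    filter_upwards [h2.eventually_lt_const (pos_iff_ne_zero.2 hε)] with M hM using hM.le
  obtain ⟨M, hM, hMM₀⟩ := (hfin.and (eventually_ge_atTop M₀)).exists
  refine ⟨M, fun k => ?_⟩
  rcases lt_or_ge k k₀ with hk | hk
  · exact (lintegral_mono_set inter_subset_right).trans (hM k (Finset.mem_range.2 hk))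
  obtain ⟨h1, h2, h3⟩ := hk₀ k hk
  set X := ∫⁻ x in {x | (k : ℝ≥0∞) < H (n k) x}ᶜ ∩ {x | (M₀ : ℝ≥0∞) < H (n k) x},
    H (n k) x ^ p ∂γ with hX
  have hXle : ∫⁻ x in {x | (k : ℝ≥0∞) < H (n k) x}ᶜ ∩ {x | (M : ℝ≥0∞) < H (n k) x},
      H (n k) x ^ p ∂γ ≤ X := by
    refine lintegral_mono_set (inter_subset_inter_right _
      fun x (hx : (M : ℝ≥0∞) < H (n k) x) => ?_)
    exact lt_of_le_of_lt (Nat.cast_le.2 hMM₀) hx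
  refine hXle.trans ?_
  have hsplit : X + J (n k) k = J (n k) M₀ := by
    simp only [hX, hJ]
    rw [← lintegral_inter_add_sdiff (μ := γ) _ {x | (M₀ : ℝ≥0∞) < H (n k) x} (hset (n k) k),
      add_comm]
    congr 2
    · congr 1
      ext x
      simp only [mem_inter_iff, mem_ofPred_eq]
      exact ⟨fun h => ⟨lt_of_le_of_lt (by exact_mod_cast h3) h, h⟩, fun h => h.2⟩
    · congr 1
      ext x
      simp [and_comm]
  -- The three thirds of `ε` come from the choice of `M₀`, the convergence at height `M₀`, and the
  -- defect `1/(k+1)` in the choice of `ψ`. The finite `L` is then cancelled.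
  have h4 : X + L ≤ ε + L := by
    calc X + L ≤ X + J' k := by gcongr; exact iInf_le _ _
      _ ≤ X + (J (n k) k + ε / 3) := by gcongr; exact (hψJ k).le.trans (by gcongr)
      _ = J (n k) M₀ + ε / 3 := by rw [← add_assoc, hsplit]
      _ ≤ L + ε / 3 + ε / 3 + ε / 3 := by gcongr
      _ = ε + L := by rw [add_assoc, add_assoc, add_comm, ← add_assoc, ENNReal.add_thirds]
  exact (ENNReal.add_le_add_iff_right hLtop).1 h4

end PowerSplitting

/-! ### Almost disjoint sequences and the passage from `L¹` to `L^p` -/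

section AlmostDisjoint

variable {α : Type*} [MeasurableSpace α] {γ : Measure α} {p : ℝ}

/-- Almost disjoint functions in `L^p` satisfy an upper `p`-estimate. -/
lemma lintegral_rpow_sum_indicator_le (hp : 1 ≤ p) {H : ℕ → α → ℝ≥0∞}
    (hH : ∀ k, Measurable (H k)) {K : ℝ≥0∞} (hHK : ∀ k, ∫⁻ x, H k x ^ p ∂γ ≤ K)
    {E : ℕ → Set α} (hE : ∀ k, MeasurableSet (E k))
    (hdisj : ∀ j k, j < k → ∫⁻ x in E k, H j x ^ p ∂γ ≤ ((2⁻¹ : ℝ≥0∞) ^ j) ^ p) (m : ℕ) :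
    ∫⁻ x, (∑ k ∈ Finset.range m, (E k).indicator (H k) x) ^ p ∂γ ≤
      m * (2 + K ^ (1 / p)) ^ p := by
  have hp0 : 0 < p := by linarith
  induction m with
  | zero => simp [hp0]
  | succ m ih =>
    -- Off `E m` the new summand vanishes and the induction hypothesis applies. On `E m` the earlier
    -- functions have norms at most `2^(-k)`, summing to at most `2`, and the new one has norm at
    -- most `K^(1/p)`.
    rw [← lintegral_add_compl _ (hE m), add_comm, Nat.cast_succ, add_mul, one_mul]
    refine add_le_add ?_ ?_
    · refine le_trans ?_ ih
      rw [← lintegral_indicator (hE m).compl]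
      refine lintegral_mono fun x => ?_
      by_cases hx : x ∈ E m
      · simp [hx]
      · simp [hx, Finset.sum_range_succ]
    · rw [← lintegralLpNorm_le_iff hp0]
      calc lintegralLpNorm p (γ.restrict (E m))
            (fun x => ∑ k ∈ Finset.range (m + 1), (E k).indicator (H k) x)
          ≤ lintegralLpNorm p (γ.restrict (E m)) (fun x => ∑ k ∈ Finset.range (m + 1), H k x) :=
            lintegralLpNorm_mono hp0 fun x => Finset.sum_le_sum fun k _ =>
              indicator_le_self _ _ _
        _ ≤ ∑ k ∈ Finset.range (m + 1), lintegralLpNorm p (γ.restrict (E m)) (H k) :=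
            lintegralLpNorm_sum_le hp hH _
        _ ≤ ∑ k ∈ Finset.range m, (2⁻¹ : ℝ≥0∞) ^ k + K ^ (1 / p) := by
            rw [Finset.sum_range_succ]
            refine add_le_add (Finset.sum_le_sum fun k hk => ?_) ?_
            · exact (lintegralLpNorm_le_iff hp0).2 (hdisj k m (Finset.mem_range.1 hk))
            · exact ENNReal.rpow_le_rpow ((setLIntegral_le_lintegral _ _).trans (hHK m))
                (by positivity)
        _ ≤ 2 + K ^ (1 / p) := by
            gcongr
            refine (ENNReal.sum_le_tsum _).trans (le_of_eq ?_)
            rw [ENNReal.tsum_geometric, ENNReal.one_sub_inv_two, inv_inv]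

/-- The expression is `m^(-(1 - 1/p)) * D^(1/p)`, and the exponent is negative because `p > 1`. -/
lemma tendsto_inv_mul_rpow_natCast (hp : 1 < p) {D : ℝ≥0∞} (hD : D ≠ ∞) :
    Tendsto (fun m : ℕ => (m : ℝ≥0∞)⁻¹ * (m * D) ^ (1 / p)) atTop (𝓝 0) := by
  have hp0 : 0 < p := by linarith
  have hq : 0 < 1 - 1 / p := by
    rw [sub_pos, div_lt_one hp0]
    exact hp
  have h1 : Tendsto (fun m : ℕ => ((m : ℝ≥0∞) ^ (1 - 1 / p))⁻¹) atTop (𝓝 0) := by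
    have := ((ENNReal.tendsto_rpow_at_top hq).comp ENNReal.tendsto_nat_nhds_top).inv
    simpa using this
  have h2 := ENNReal.Tendsto.const_mul h1
    (Or.inr (ENNReal.rpow_ne_top_of_nonneg (by positivity : 0 ≤ 1 / p) hD))
  rw [mul_zero] at h2
  refine h2.congr' ?_
  filter_upwards [eventually_gt_atTop 0] with m hm
  have hm0 : (m : ℝ≥0∞) ≠ 0 := by exact_mod_cast hm.ne'
  rw [ENNReal.mul_rpow_of_nonneg _ _ (by positivity), ← ENNReal.rpow_neg,
    neg_sub, ENNReal.rpow_sub _ _ hm0 (ENNReal.natCast_ne_top m), ENNReal.rpow_one,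
    ENNReal.div_eq_inv_mul]
  ring

lemma min_rpow_le (hp : 1 ≤ p) (a b : ℝ≥0∞) : min a b ^ p ≤ b ^ (p - 1) * a := by
  calc min a b ^ p = min a b ^ (p - 1 + 1) := by rw [sub_add_cancel]
    _ = min a b ^ (p - 1) * min a b := by
        rw [ENNReal.rpow_add_of_nonneg _ _ (by linarith) zero_le_one, ENNReal.rpow_one]
    _ ≤ b ^ (p - 1) * a := by
        exact mul_le_mul' (ENNReal.rpow_le_rpow (min_le_right _ _) (by linarith)) (min_le_left _ _)

/-- `Φ m` is bounded by three pieces: its truncation at `M`, controlled by the `L¹` norm through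
`min_rpow_le`; the mean of the parts of `H k` above `M` off `E k`, small by equi-integrability; and
the mean of the parts on `E k`, small by the upper `p`-estimate. -/
lemma tendsto_lintegral_rpow_of_le_mean (hp : 1 < p) {H : ℕ → α → ℝ≥0∞}
    (hH : ∀ k, Measurable (H k)) {K : ℝ≥0∞} (hK : K ≠ ∞) (hHK : ∀ k, ∫⁻ x, H k x ^ p ∂γ ≤ K)
    {E : ℕ → Set α} (hE : ∀ k, MeasurableSet (E k))
    (hdisj : ∀ j k, j < k → ∫⁻ x in E k, H j x ^ p ∂γ ≤ ((2⁻¹ : ℝ≥0∞) ^ j) ^ p)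
    (hequi : ∀ ε : ℝ≥0∞, ε ≠ 0 → ∃ M : ℕ, ∀ k,
      ∫⁻ x in (E k)ᶜ ∩ {x | (M : ℝ≥0∞) < H k x}, H k x ^ p ∂γ ≤ ε)
    {Φ : ℕ → α → ℝ≥0∞} (hΦ : ∀ m, Measurable (Φ m))
    (hle : ∀ m x, Φ m x ≤ (m : ℝ≥0∞)⁻¹ * ∑ i ∈ Finset.range m, H i x)
    (hlim : Tendsto (fun m => ∫⁻ x, Φ m x ∂γ) atTop (𝓝 0)) :
    Tendsto (fun m => ∫⁻ x, Φ m x ^ p ∂γ) atTop (𝓝 0) := by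
  have hp0 : 0 < p := by linarith
  suffices hN : Tendsto (fun m => lintegralLpNorm p γ (Φ m)) atTop (𝓝 0) by
    have := ((ENNReal.continuous_rpow_const (y := p)).tendsto 0).comp hN
    rw [ENNReal.zero_rpow_of_pos hp0] at this
    exact this.congr fun m => lintegralLpNorm_rpow hp0 _
  set D : ℝ≥0∞ := (2 + K ^ (1 / p)) ^ p with hDdef
  have hD : D ≠ ∞ := ENNReal.rpow_ne_top_of_nonneg hp0.le
    (ENNReal.add_ne_top.2 ⟨by norm_num, ENNReal.rpow_ne_top_of_nonneg (by positivity) hK⟩)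
  have hB := tendsto_inv_mul_rpow_natCast hp hD
  rw [ENNReal.tendsto_atTop_zero]
  intro ε hε
  rcases eq_or_ne ε ∞ with rfl | hεtop
  · exact ⟨0, fun _ _ => le_top⟩
  have hε3 : 0 < ε / 3 := ENNReal.div_pos hε.ne' (by norm_num)
  obtain ⟨M, hM⟩ := hequi ((ε / 3) ^ p) (ENNReal.rpow_pos hε3
    (ENNReal.div_ne_top hεtop (by norm_num))).ne'
  have hA : Tendsto (fun m => ((M : ℝ≥0∞) ^ (p - 1) * ∫⁻ x, Φ m x ∂γ) ^ (1 / p)) atTop (𝓝 0) := by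
    have h1 := ENNReal.Tendsto.const_mul hlim (Or.inr (ENNReal.rpow_ne_top_of_nonneg
      (by linarith : 0 ≤ p - 1) (ENNReal.natCast_ne_top M)))
    rw [mul_zero] at h1
    have h2 := ((ENNReal.continuous_rpow_const (y := 1 / p)).tendsto 0).comp h1
    rwa [ENNReal.zero_rpow_of_pos (by positivity)] at h2
  obtain ⟨N, hN⟩ := eventually_atTop.1 ((hA.eventually_lt_const hε3).and
    (hB.eventually_lt_const hε3))
  refine ⟨N, fun m hm => ?_⟩
  obtain ⟨hm1, hm2⟩ := hN m hm
  set V : ℕ → Set α := fun k => (E k)ᶜ ∩ {x | (M : ℝ≥0∞) < H k x} with hV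
  have hVm : ∀ k, MeasurableSet (V k) := fun k =>
    (hE k).compl.inter (measurableSet_lt measurable_const (hH k))
  have hind : ∀ k, Measurable ((V k).indicator (H k)) := fun k => (hH k).indicator (hVm k)
  have hindE : ∀ k, Measurable ((E k).indicator (H k)) := fun k => (hH k).indicator (hE k)
  have hpt : ∀ k x, H k x ≤ M + ((V k).indicator (H k) x + (E k).indicator (H k) x) := by
    intro k x
    by_cases hxE : x ∈ E k
    · rw [indicator_of_mem hxE]
      exact le_add_self.trans le_add_self
    · by_cases hxM : (M : ℝ≥0∞) < H k x
      · have : x ∈ V k := ⟨hxE, hxM⟩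
        rw [indicator_of_mem this]
        exact le_self_add.trans le_add_self
      · exact (not_lt.1 hxM).trans le_self_add
  -- Where `Φ m x ≤ M` the first term suffices. Elsewhere the first term is `M`, which absorbs the
  -- mean of the constants `M` from `hpt`.
  have hΦle : ∀ x, Φ m x ≤ min (Φ m x) M +
      ((m : ℝ≥0∞)⁻¹ * ∑ k ∈ Finset.range m, (V k).indicator (H k) x +
        (m : ℝ≥0∞)⁻¹ * ∑ k ∈ Finset.range m, (E k).indicator (H k) x) := by
    intro x
    rw [← mul_add, ← Finset.sum_add_distrib]
    rcases le_total (Φ m x) M with h | h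
    · rw [min_eq_left h]
      exact le_self_add
    · rw [min_eq_right h]
      refine (hle m x).trans ?_
      calc (m : ℝ≥0∞)⁻¹ * ∑ i ∈ Finset.range m, H i x
          ≤ (m : ℝ≥0∞)⁻¹ * ∑ k ∈ Finset.range m,
              (M + ((V k).indicator (H k) x + (E k).indicator (H k) x)) := by
            gcongr with k
            exact hpt k x
        _ = (m : ℝ≥0∞)⁻¹ * m * M + (m : ℝ≥0∞)⁻¹ * ∑ k ∈ Finset.range m,
              ((V k).indicator (H k) x + (E k).indicator (H k) x) := by
            rw [Finset.sum_add_distrib, mul_add]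
            simp [mul_assoc]
        _ ≤ _ := by
            gcongr
            exact (mul_le_mul_left (ENNReal.inv_mul_le_one _) _).trans (one_mul _).le
  calc lintegralLpNorm p γ (Φ m)
      ≤ _ := lintegralLpNorm_mono hp0 hΦle
    _ ≤ lintegralLpNorm p γ (fun x => min (Φ m x) M) +
        (lintegralLpNorm p γ (fun x =>
            (m : ℝ≥0∞)⁻¹ * ∑ k ∈ Finset.range m, (V k).indicator (H k) x) +
          lintegralLpNorm p γ (fun x =>
            (m : ℝ≥0∞)⁻¹ * ∑ k ∈ Finset.range m, (E k).indicator (H k) x)) := by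
        have hm3 : Measurable fun x =>
            (m : ℝ≥0∞)⁻¹ * ∑ k ∈ Finset.range m, (V k).indicator (H k) x :=
          (Finset.measurable_fun_sum _ fun k _ => hind k).const_mul _
        have hm4 : Measurable fun x =>
            (m : ℝ≥0∞)⁻¹ * ∑ k ∈ Finset.range m, (E k).indicator (H k) x :=
          (Finset.measurable_fun_sum _ fun k _ => hindE k).const_mul _
        exact (lintegralLpNorm_add_le hp.le ((hΦ m).min measurable_const) (hm3.add hm4)).trans
          (add_le_add_right (lintegralLpNorm_add_le hp.le hm3 hm4) _)
    _ ≤ ε / 3 + (ε / 3 + ε / 3) := by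
        refine add_le_add ?_ (add_le_add ?_ ?_)
        · refine le_trans (ENNReal.rpow_le_rpow ?_ (by positivity)) hm1.le
          rw [← lintegral_const_mul _ (hΦ m)]
          exact lintegral_mono fun x => min_rpow_le hp.le _ _
        · rw [lintegralLpNorm_const_mul hp0 (Finset.measurable_fun_sum _ fun k _ => hind k)]
          calc (m : ℝ≥0∞)⁻¹ * lintegralLpNorm p γ
                (fun x => ∑ k ∈ Finset.range m, (V k).indicator (H k) x)
              ≤ (m : ℝ≥0∞)⁻¹ * ∑ k ∈ Finset.range m, ε / 3 := by
                gcongr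
                refine (lintegralLpNorm_sum_le hp.le hind m).trans (Finset.sum_le_sum fun k _ => ?_)
                rw [lintegralLpNorm_le_iff hp0]
                refine le_trans (le_of_eq ?_) (hM k)
                rw [← lintegral_indicator (hVm k)]
                congr 1
                ext x
                by_cases hx : x ∈ V k <;> simp [hx, hp0]
            _ = (m : ℝ≥0∞)⁻¹ * m * (ε / 3) := by simp [mul_assoc]
            _ ≤ ε / 3 := (mul_le_mul_left (ENNReal.inv_mul_le_one _) _).trans (one_mul _).le
        · rw [lintegralLpNorm_const_mul hp0 (Finset.measurable_fun_sum _ fun k _ => hindE k)]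
          refine le_trans ?_ hm2.le
          gcongr
          exact ENNReal.rpow_le_rpow
            (lintegral_rpow_sum_indicator_le hp.le hH hHK hE hdisj m) (by positivity)
    _ = ε := by rw [← add_assoc, ENNReal.add_thirds]

/-- A bounded sequence `H` in `L^p`, `1 < p`, has a subsequence such that, for functions dominated
by the means of any further subsequence, convergence to zero in `L¹` implies convergence to zero
in `L^p`. -/
theorem exists_strictMono_tendsto_lintegral_rpow (hp : 1 < p) {H : ℕ → α → ℝ≥0∞}
    (hH : ∀ k, Measurable (H k)) {K : ℝ≥0∞} (hK : K ≠ ∞) (hHK : ∀ k, ∫⁻ x, H k x ^ p ∂γ ≤ K) :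
    ∃ n : ℕ → ℕ, StrictMono n ∧ ∀ l : ℕ → ℕ, StrictMono l → ∀ Φ : ℕ → α → ℝ≥0∞,
      (∀ m, Measurable (Φ m)) →
      (∀ m x, Φ m x ≤ (m : ℝ≥0∞)⁻¹ * ∑ i ∈ Finset.range m, H (n (l i)) x) →
      Tendsto (fun m => ∫⁻ x, Φ m x ∂γ) atTop (𝓝 0) →
      Tendsto (fun m => ∫⁻ x, Φ m x ^ p ∂γ) atTop (𝓝 0) := by
  have hp0 : 0 < p := by linarith
  obtain ⟨n, hn, E, hE, hE0, hequi⟩ := exists_strictMono_equiintegrable_off hp.le hH hK hHK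
  -- As `γ (E k)` tends to zero, each fixed `H (n j) ^ p` has vanishing integral over `E k`, so a
  -- thinner subsequence is almost disjoint.
  obtain ⟨θ, hθ, hdisj⟩ := exists_strictMono_forall_lt_rel
    (r := fun j k => ∫⁻ x in E k, H (n j) x ^ p ∂γ ≤ ((2⁻¹ : ℝ≥0∞) ^ j) ^ p) fun j => by
      have h1 := tendsto_setLIntegral_zero (ne_top_of_le_ne_top hK (hHK (n j))) hE0
      have h2 : (0 : ℝ≥0∞) < ((2⁻¹ : ℝ≥0∞) ^ j) ^ p :=
        ENNReal.rpow_pos (ENNReal.pow_pos (by simp) j) (by finiteness)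
      filter_upwards [h1.eventually_lt_const h2] with k hk using hk.le
  refine ⟨fun k => n (θ k), hn.comp hθ, fun l hl Φ hΦ hle hlim => ?_⟩
  refine tendsto_lintegral_rpow_of_le_mean hp (H := fun i => H (n (θ (l i)))) (fun k => hH _) hK
    (fun k => hHK _) (E := fun i => E (θ (l i))) (fun k => hE _) (fun j k hjk => ?_)
    (fun ε hε => ?_) hΦ hle hlim
  -- The estimates survive further extraction because `j ≤ θ (l j)`, so the required bound `2^(-j)`
  -- only gets weaker than the one available.
  · refine (hdisj _ _ (hl hjk)).trans (ENNReal.rpow_le_rpow ?_ hp0.le)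
    exact pow_le_pow_right_of_le_one' (by simp) ((hl.le_apply).trans hθ.le_apply)
  · obtain ⟨M, hM⟩ := hequi ε hε
    exact ⟨M, fun k => hM _⟩

end AlmostDisjoint

/-! ### Cesàro means and the weighted `L¹` measure -/

section CesMean

instance instSigmaFiniteCesMeasure (I : CesDomain) : SigmaFinite I.measure := by
  unfold CesDomain.measure
  infer_instance

/-- The function `x ↦ (1/x) ∫_0^x g(t) dt`. -/
noncomputable def cesMean (I : CesDomain) (g : ℝ → ℝ≥0∞) (x : ℝ) : ℝ≥0∞ :=
  (∫⁻ t in Ioc 0 x, g t ∂I.measure) / ENNReal.ofReal x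

variable {I : CesDomain} {p : ℝ}

lemma cesMean_mono_ae {f g : ℝ → ℝ≥0∞} (h : ∀ᵐ t ∂I.measure, f t ≤ g t) (x : ℝ) :
    cesMean I f x ≤ cesMean I g x :=
  ENNReal.div_le_div_right (lintegral_mono_ae (ae_restrict_of_ae h)) _

lemma cesMean_one_le (x : ℝ) : cesMean I (fun _ => 1) x ≤ 1 := by
  refine ENNReal.div_le_of_le_mul ?_
  rw [lintegral_one, Measure.restrict_apply_univ, one_mul]
  refine (Measure.restrict_apply_le _ _).trans (le_of_eq ?_)
  rw [Real.volume_Ioc, sub_zero]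

lemma cesENorm_rpow (hp : 0 < p) (f : ℝ →ₘ[I.measure] ℝ) :
    cesENorm p I f ^ p = ∫⁻ x, cesMean I (fun t => ‖f t‖ₑ) x ^ p ∂I.measure :=
  lintegralLpNorm_rpow hp _

lemma cesMean_enorm_add_le (f g : ℝ →ₘ[I.measure] ℝ) (x : ℝ) :
    cesMean I (fun t => ‖(f + g) t‖ₑ) x ≤
      cesMean I (fun t => ‖f t‖ₑ) x + cesMean I (fun t => ‖g t‖ₑ) x := by
  refine (cesMean_mono_ae (g := fun t => ‖f t‖ₑ + ‖g t‖ₑ) ?_ x).trans (le_of_eq ?_)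
  · filter_upwards [AEEqFun.coeFn_add f g] with t ht
    rw [ht]
    exact enorm_add_le _ _
  · rw [cesMean, lintegral_add_left' (aemeasurable_enorm f).restrict, ENNReal.add_div]
    rfl

lemma cesMean_enorm_zero (x : ℝ) :
    cesMean I (fun t => ‖(0 : ℝ →ₘ[I.measure] ℝ) t‖ₑ) x = 0 := by
  rw [← nonpos_iff_eq_zero]
  refine (cesMean_mono_ae (g := fun _ => 0) ?_ x).trans (by simp [cesMean])
  filter_upwards [AEEqFun.coeFn_zero (α := ℝ) (β := ℝ) (μ := I.measure)] with t ht
  simp [ht]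

lemma cesMean_enorm_smul_le (c : ℝ) (f : ℝ →ₘ[I.measure] ℝ) (x : ℝ) :
    cesMean I (fun t => ‖(c • f) t‖ₑ) x ≤ ‖c‖ₑ * cesMean I (fun t => ‖f t‖ₑ) x := by
  refine (cesMean_mono_ae (g := fun t => ‖c‖ₑ * ‖f t‖ₑ) ?_ x).trans (le_of_eq ?_)
  · filter_upwards [AEEqFun.coeFn_smul c f] with t ht
    simp [ht, enorm_mul]
  · rw [cesMean, lintegral_const_mul' _ _ enorm_ne_top, mul_div_assoc]
    rfl

/-- Pointwise sublinearity of the Cesàro mean of `|f|`; it supplies the domination hypothesis of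
`exists_strictMono_tendsto_lintegral_rpow`. -/
lemma cesMean_enorm_mean_le [Fact (1 ≤ p)] (f : ℕ → Ces p I) (m : ℕ) (x : ℝ) :
    cesMean I (fun t => ‖((m : ℝ)⁻¹ • ∑ i ∈ Finset.range m, f i : Ces p I).1 t‖ₑ) x ≤
      (m : ℝ≥0∞)⁻¹ * ∑ i ∈ Finset.range m, cesMean I (fun t => ‖(f i).1 t‖ₑ) x := by
  have hsum : ∀ m : ℕ, cesMean I (fun t => ‖(∑ i ∈ Finset.range m, f i : Ces p I).1 t‖ₑ) x ≤
      ∑ i ∈ Finset.range m, cesMean I (fun t => ‖(f i).1 t‖ₑ) x := by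
    intro m
    induction m with
    | zero => exact (cesMean_enorm_zero x).le
    | succ m ih =>
      rw [Finset.sum_range_succ, Finset.sum_range_succ]
      exact (cesMean_enorm_add_le _ _ x).trans (add_le_add_left ih _)
  refine (cesMean_enorm_smul_le _ _ x).trans (mul_le_mul' ?_ (hsum m))
  rcases Nat.eq_zero_or_pos m with rfl | hm
  · simp
  · have : (m : ℝ) ≠ 0 := by exact_mod_cast hm.ne'
    rw [enorm_inv this]
    simp

/-- The decreasing exponential on the line. -/
noncomputable def expWeight (x : ℝ) : ℝ≥0∞ := ENNReal.ofReal (Real.exp (-x))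

lemma measurable_expWeight : Measurable expWeight := by
  unfold expWeight
  fun_prop

lemma expWeight_ne_zero (x : ℝ) : expWeight x ≠ 0 := by simp [expWeight, Real.exp_pos]

lemma expWeight_ne_top (x : ℝ) : expWeight x ≠ ∞ := ENNReal.ofReal_ne_top

lemma lintegral_expWeight_rpow_ne_top {q : ℝ} (hq : 0 ≤ q)
    (h : 0 < q ∨ I = CesDomain.unitInterval) :
    ∫⁻ x, expWeight x ^ q ∂I.measure ≠ ∞ := by
  have hexp : ∀ x, expWeight x ^ q = ENNReal.ofReal (Real.exp (-q * x)) := fun x => by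
    rw [expWeight, ENNReal.ofReal_rpow_of_pos (Real.exp_pos _), ← Real.exp_mul]
    congr 2
    ring
  simp_rw [hexp]
  rcases I with _ | _
  · have h1 : ∫⁻ x, ENNReal.ofReal (Real.exp (-q * x)) ∂CesDomain.unitInterval.measure ≤
        ∫⁻ _, 1 ∂CesDomain.unitInterval.measure := by
      refine lintegral_mono_ae ?_
      filter_upwards [ae_restrict_mem (μ := volume) CesDomain.unitInterval.toSet_measurable]
        with x hx
      rw [← ENNReal.ofReal_one]
      refine ENNReal.ofReal_le_ofReal (Real.exp_le_one_iff.2 ?_)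
      nlinarith [mul_nonneg hq hx.1]
    refine ne_top_of_le_ne_top ?_ h1
    simp [CesDomain.measure, CesDomain.toSet]
  · have hq0 : 0 < q := h.resolve_right (by simp)
    have h1 : IntegrableOn (fun x => Real.exp (-q * x)) (Ici 0) :=
      (integrableOn_Ici_iff_integrableOn_Ioi (by simp)).2 (exp_neg_integrableOn_Ioi 0 hq0)
    exact (h1.lintegral_lt_top).ne

lemma mul_rpow_sub_one_le (hp : 1 ≤ p) (a b : ℝ≥0∞) : a * b ^ (p - 1) ≤ a ^ p + b ^ p := by
  have hpow : ∀ c : ℝ≥0∞, c * c ^ (p - 1) = c ^ p := fun c => by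
    conv_lhs => rw [← ENNReal.rpow_one c, ← ENNReal.rpow_mul, one_mul,
      ← ENNReal.rpow_add_of_nonneg _ _ zero_le_one (by linarith), add_sub_cancel]
  rcases le_total a b with h | h
  · exact ((mul_le_mul_left h _).trans (hpow b).le).trans le_add_self
  · exact ((mul_le_mul_right (ENNReal.rpow_le_rpow h (by linarith)) _).trans
      (hpow a).le).trans le_self_add

/-- The density `t ↦ ∫_t^∞ e^{-(p-1)x} dx/x` on `I`. -/
noncomputable def cesDensity (p : ℝ) (I : CesDomain) (t : ℝ) : ℝ≥0∞ :=
  ∫⁻ x, {z : ℝ × ℝ | 0 < z.1 ∧ z.1 ≤ z.2}.indicator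
    (fun z => expWeight z.2 ^ (p - 1) / ENNReal.ofReal z.2) (t, x) ∂I.measure

/-- The measure on `I` such that `Ces_p(I)` embeds into its `L¹` space. -/
noncomputable def cesL1Measure (p : ℝ) (I : CesDomain) : Measure ℝ :=
  I.measure.withDensity (cesDensity p I)

lemma measurable_cesDensity_kernel (p : ℝ) :
    Measurable ({z : ℝ × ℝ | 0 < z.1 ∧ z.1 ≤ z.2}.indicator
      fun z => expWeight z.2 ^ (p - 1) / ENNReal.ofReal z.2) := by
  refine Measurable.indicator ?_ ?_
  · exact ((measurable_expWeight.comp measurable_snd).pow_const _).div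
      (ENNReal.measurable_ofReal.comp measurable_snd)
  · exact (measurableSet_lt measurable_const measurable_fst).inter
      (measurableSet_le measurable_fst measurable_snd)

lemma measurable_cesDensity : Measurable (cesDensity p I) :=
  (measurable_cesDensity_kernel p).lintegral_prod_right'

lemma cesL1Measure_absolutelyContinuous : cesL1Measure p I ≪ I.measure :=
  withDensity_absolutelyContinuous _ _

/-- Tonelli: the density at `t` collects the weights of all `x ≥ t` whose Cesàro mean sees `g t`. -/
lemma lintegral_cesL1Measure {g : ℝ → ℝ≥0∞} (hg : AEMeasurable g I.measure) :
    ∫⁻ t, g t ∂cesL1Measure p I = ∫⁻ x, cesMean I g x * expWeight x ^ (p - 1) ∂I.measure := by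
  have hprod : AEMeasurable (Function.uncurry fun t x =>
      {z : ℝ × ℝ | 0 < z.1 ∧ z.1 ≤ z.2}.indicator
        (fun z => expWeight z.2 ^ (p - 1) / ENNReal.ofReal z.2) (t, x) * g t)
      (I.measure.prod I.measure) :=
    (measurable_cesDensity_kernel p).aemeasurable.mul hg.comp_fst
  rw [cesL1Measure, lintegral_withDensity_eq_lintegral_mul₀ measurable_cesDensity.aemeasurable hg]
  calc ∫⁻ t, (cesDensity p I * g) t ∂I.measure
      = ∫⁻ t, ∫⁻ x, {z : ℝ × ℝ | 0 < z.1 ∧ z.1 ≤ z.2}.indicator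
        (fun z => expWeight z.2 ^ (p - 1) / ENNReal.ofReal z.2) (t, x) * g t
          ∂I.measure ∂I.measure := by
        refine lintegral_congr fun t => ?_
        rw [Pi.mul_apply, cesDensity, lintegral_mul_const]
        exact (measurable_cesDensity_kernel p).comp measurable_prodMk_left
    _ = ∫⁻ x, ∫⁻ t, {z : ℝ × ℝ | 0 < z.1 ∧ z.1 ≤ z.2}.indicator
        (fun z => expWeight z.2 ^ (p - 1) / ENNReal.ofReal z.2) (t, x) * g t
          ∂I.measure ∂I.measure := lintegral_lintegral_swap hprod
    _ = ∫⁻ x, cesMean I g x * expWeight x ^ (p - 1) ∂I.measure := by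
        refine lintegral_congr fun x => ?_
        have h1 : ∀ t, {z : ℝ × ℝ | 0 < z.1 ∧ z.1 ≤ z.2}.indicator
            (fun z => expWeight z.2 ^ (p - 1) / ENNReal.ofReal z.2) (t, x) * g t =
            (Ioc 0 x).indicator (fun t => expWeight x ^ (p - 1) / ENNReal.ofReal x * g t) t := by
          intro t
          by_cases ht : 0 < t ∧ t ≤ x
          · rw [indicator_of_mem (by exact ht), indicator_of_mem (by exact ht)]
          · rw [indicator_of_notMem (by exact ht), indicator_of_notMem (by exact ht), zero_mul]
        simp_rw [h1]
        rw [lintegral_indicator measurableSet_Ioc, lintegral_const_mul'' _ hg.restrict, cesMean]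
        simp only [div_eq_mul_inv]
        ring

lemma lintegral_cesL1Measure_le (hp : 1 ≤ p) (f : ℝ →ₘ[I.measure] ℝ) :
    ∫⁻ t, ‖f t‖ₑ ∂cesL1Measure p I ≤
      cesENorm p I f ^ p + ∫⁻ x, expWeight x ^ p ∂I.measure := by
  rw [lintegral_cesL1Measure (aemeasurable_enorm f), cesENorm_rpow (by linarith),
    ← lintegral_add_right _ (measurable_expWeight.pow_const p)]
  exact lintegral_mono fun x => mul_rpow_sub_one_le hp _ _

/-- The Cesàro mean of `1` is at most `1`, so the total mass is at most `∫ w^(p-1)`. For `p = 1`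
this is the length of the interval, which has to be finite. -/
lemma isFiniteMeasure_cesL1Measure (hp : 1 ≤ p) (h : 1 < p ∨ I = CesDomain.unitInterval) :
    IsFiniteMeasure (cesL1Measure p I) := by
  refine ⟨?_⟩
  rw [← lintegral_one, lintegral_cesL1Measure aemeasurable_const]
  refine lt_of_le_of_lt (lintegral_mono fun x => ?_)
    (lintegral_expWeight_rpow_ne_top (I := I) (sub_nonneg.2 hp) (h.imp_left sub_pos.2)).lt_top
  exact (mul_le_mul_left (cesMean_one_le x) _).trans (one_mul _).le

end CesMean

/-! ### Embedding into weighted `L¹` and the cases of the theorem -/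

section Embedding

variable {I : CesDomain} {p : ℝ} [hp : Fact (1 ≤ p)]

lemma Ces.ofReal_norm (f : Ces p I) : ENNReal.ofReal ‖f‖ = cesENorm p I f.1 :=
  ENNReal.ofReal_toReal (Ces.ne_top f)

lemma Ces.memLp_cesL1Measure (f : Ces p I) :
    MemLp f.1 1 (cesL1Measure p I) := by
  refine ⟨f.1.aestronglyMeasurable.mono_ac cesL1Measure_absolutelyContinuous, ?_⟩
  rw [eLpNorm_one_eq_lintegral_enorm]
  have hp0 : 0 < p := one_pos.trans_le hp.out
  refine (lintegral_cesL1Measure_le hp.out f.1).trans_lt (ENNReal.add_lt_top.2 ⟨?_, ?_⟩)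
  · exact ENNReal.rpow_lt_top_of_nonneg hp0.le (Ces.ne_top f)
  · exact (lintegral_expWeight_rpow_ne_top hp0.le (Or.inl hp0)).lt_top

/-- The inclusion of `Ces_p(I)` into a weighted `L¹` space, as a linear map. -/
noncomputable def cesToL1Linear (p : ℝ) [hp : Fact (1 ≤ p)] (I : CesDomain) :
    Ces p I →ₗ[ℝ] Lp ℝ 1 (cesL1Measure p I) where
  toFun f := (Ces.memLp_cesL1Measure f).toLp f.1
  map_add' f g := by
    rw [← MemLp.toLp_add]
    exact MemLp.toLp_congr _ _
      (cesL1Measure_absolutelyContinuous.ae_eq (AEEqFun.coeFn_add f.1 g.1))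
  map_smul' c f := by
    rw [RingHom.id_apply, ← MemLp.toLp_const_smul]
    exact MemLp.toLp_congr _ _
      (cesL1Measure_absolutelyContinuous.ae_eq (AEEqFun.coeFn_smul c f.1))

lemma norm_cesToL1Linear (f : Ces p I) :
    ‖cesToL1Linear p I f‖ = (∫⁻ t, ‖f.1 t‖ₑ ∂cesL1Measure p I).toReal := by
  rw [← eLpNorm_one_eq_lintegral_enorm]
  exact Lp.norm_toLp _ (Ces.memLp_cesL1Measure f)

lemma exists_bound_cesToL1Linear :
    ∃ C, ∀ f : Ces p I, ‖cesToL1Linear p I f‖ ≤ C * ‖f‖ := by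
  have hp0 : 0 < p := one_pos.trans_le hp.out
  have hG := lintegral_expWeight_rpow_ne_top (I := I) hp0.le (Or.inl hp0)
  -- The estimate `a * b^(p-1) ≤ a^p + b^p` is not homogeneous, so it is used on the unit ball only,
  -- and linearity does the rest.
  refine LinearMap.bound_of_ball_bound one_pos
    (1 + ∫⁻ x, expWeight x ^ p ∂I.measure).toReal (cesToL1Linear p I) fun f hf => ?_
  rw [norm_cesToL1Linear]
  refine ENNReal.toReal_mono (ENNReal.add_ne_top.2 ⟨ENNReal.one_ne_top, hG⟩) ?_
  refine (lintegral_cesL1Measure_le hp.out f.1).trans (add_le_add_left ?_ _)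
  refine ENNReal.rpow_le_one ?_ hp0.le
  rw [← Ces.ofReal_norm, ENNReal.ofReal_le_one]
  exact (mem_ball_zero_iff.1 hf).le

/-- The inclusion of `Ces_p(I)` into a weighted `L¹` space. -/
noncomputable def cesToL1 (p : ℝ) [hp : Fact (1 ≤ p)] (I : CesDomain) :
    Ces p I →L[ℝ] Lp ℝ 1 (cesL1Measure p I) :=
  (cesToL1Linear p I).mkContinuousOfExistsBound exists_bound_cesToL1Linear

lemma ofReal_norm_cesToL1 (f : Ces p I) :
    ENNReal.ofReal ‖cesToL1 p I f‖ =
      ∫⁻ x, cesMean I (fun t => ‖f.1 t‖ₑ) x * expWeight x ^ (p - 1) ∂I.measure := by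
  rw [← lintegral_cesL1Measure (aemeasurable_enorm f.1)]
  change ENNReal.ofReal ‖cesToL1Linear p I f‖ = _
  rw [norm_cesToL1Linear, ENNReal.ofReal_toReal]
  have := (Ces.memLp_cesL1Measure f).2
  rw [eLpNorm_one_eq_lintegral_enorm] at this
  exact this.ne

/-- Along a subsequence of any weakly null sequence in `Ces_p(I)`, the means tend to zero in the
weighted `L¹` space. -/
lemma exists_strictMono_tendsto_cesToL1 (h : 1 < p ∨ I = CesDomain.unitInterval)
    {f : ℕ → Ces p I} (hf : ∀ φ : StrongDual ℝ (Ces p I), Tendsto (fun n => φ (f n)) atTop (𝓝 0)) :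
    ∃ n : ℕ → ℕ, StrictMono n ∧ Tendsto (fun m : ℕ =>
      ‖cesToL1 p I ((m : ℝ)⁻¹ • ∑ i ∈ Finset.range m, f (n i))‖) atTop (𝓝 0) := by
  have := isFiniteMeasure_cesL1Measure hp.out h
  obtain ⟨n, hn, hlim⟩ := weakBanachSaks_L1 (cesL1Measure p I) (fun k => cesToL1 p I (f k))
    fun φ => hf (φ.comp (cesToL1 p I))
  refine ⟨n, hn, hlim.congr fun m => ?_⟩
  rw [map_smul, map_sum, norm_smul, norm_inv, RCLike.norm_natCast, one_div]

lemma weakBanachSaks_of_tendsto_mean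
    (h : ∀ f : ℕ → Ces p I,
      (∀ φ : StrongDual ℝ (Ces p I), Tendsto (fun n => φ (f n)) atTop (𝓝 0)) →
      ∃ n : ℕ → ℕ, StrictMono n ∧ Tendsto (fun m : ℕ =>
        cesENorm p I ((m : ℝ)⁻¹ • ∑ i ∈ Finset.range m, f (n i) : Ces p I).1) atTop (𝓝 0)) :
    WeakBanachSaks (Ces p I) := by
  intro f hf
  obtain ⟨n, hn, hlim⟩ := h f hf
  refine ⟨n, hn, ?_⟩
  have := (ENNReal.tendsto_toReal ENNReal.zero_ne_top).comp hlim
  refine this.congr fun m => ?_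
  rw [Function.comp_apply, ← Ces.norm_def, norm_smul, norm_inv, RCLike.norm_natCast, one_div]

theorem weakBanachSaks_ces_of_one_lt (h : 1 < p) : WeakBanachSaks (Ces p I) := by
  refine weakBanachSaks_of_tendsto_mean fun f hf => ?_
  have hp0 : 0 < p := one_pos.trans h
  -- With density `w^p` and `Q g` the Cesàro mean divided by `w`, the `L^p(γ)` norm of `Q g` is the
  -- Cesàro norm of `g`, and its `L¹(γ)` norm is the norm of `cesToL1 p I g`.
  set γ : Measure ℝ := I.measure.withDensity fun x => expWeight x ^ p with hγ
  set Q : Ces p I → ℝ → ℝ≥0∞ :=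
    fun g x => cesMean I (fun t => ‖g.1 t‖ₑ) x * (expWeight x)⁻¹ with hQ
  have hQm : ∀ g, Measurable (Q g) := fun g =>
    (measurable_cesMean I _).mul measurable_expWeight.inv
  have hQ1 : ∀ g, ∫⁻ x, Q g x ∂γ = ENNReal.ofReal ‖cesToL1 p I g‖ := by
    intro g
    rw [ofReal_norm_cesToL1, hγ, lintegral_withDensity_eq_lintegral_mul _
      (measurable_expWeight.pow_const p) (hQm g)]
    refine lintegral_congr fun x => ?_
    rw [Pi.mul_apply, ENNReal.rpow_sub _ _ (expWeight_ne_zero x) (expWeight_ne_top x),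
      ENNReal.rpow_one, ENNReal.div_eq_inv_mul]
    simp only [hQ]
    ring
  have hQp : ∀ g, ∫⁻ x, Q g x ^ p ∂γ = cesENorm p I g.1 ^ p := by
    intro g
    rw [cesENorm_rpow hp0, hγ, lintegral_withDensity_eq_lintegral_mul _
      (measurable_expWeight.pow_const p) ((hQm g).pow_const p)]
    refine lintegral_congr fun x => ?_
    rw [Pi.mul_apply, ← ENNReal.mul_rpow_of_nonneg _ _ hp0.le, mul_left_comm,
      ENNReal.mul_inv_cancel (expWeight_ne_zero x) (expWeight_ne_top x), mul_one]
  obtain ⟨C, hC⟩ := exists_norm_le_of_weakly_null hf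
  -- The splitting subsequence is taken first: its conclusion holds for all further subsequences,
  -- whereas the convergence of means from Szlenk's theorem is known only for the subsequence it
  -- provides.
  obtain ⟨n, hn, hsub⟩ := exists_strictMono_tendsto_lintegral_rpow (γ := γ) h
    (H := fun k => Q (f k)) (fun k => hQm _) (K := ENNReal.ofReal C ^ p)
    (ENNReal.rpow_ne_top_of_nonneg hp0.le ENNReal.ofReal_ne_top) fun k => by
      rw [hQp, ← Ces.ofReal_norm]
      exact ENNReal.rpow_le_rpow (ENNReal.ofReal_le_ofReal (hC k)) hp0.le
  obtain ⟨l, hl, hlim⟩ := exists_strictMono_tendsto_cesToL1 (Or.inl h) (f := fun k => f (n k))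
    fun φ => (hf φ).comp hn.tendsto_atTop
  refine ⟨fun k => n (l k), hn.comp hl, ?_⟩
  have key := hsub l hl (fun m => Q ((m : ℝ)⁻¹ • ∑ i ∈ Finset.range m, f (n (l i))))
    (fun m => hQm _) (fun m x => by
      simp only [hQ]
      rw [← Finset.sum_mul, ← mul_assoc]
      exact mul_le_mul_left (cesMean_enorm_mean_le (fun i => f (n (l i))) m x) _) (by
      simp_rw [hQ1]
      simpa using ENNReal.tendsto_ofReal hlim)
  simp_rw [hQp] at key
  have h2 := ((ENNReal.continuous_rpow_const (y := 1 / p)).tendsto 0).comp key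
  rw [ENNReal.zero_rpow_of_pos (by positivity)] at h2
  refine h2.congr fun m => ?_
  rw [Function.comp_apply, one_div, ENNReal.rpow_rpow_inv hp0.ne']

/-- For `p = 1` the weight `w^(p-1)` is `1`, so the weighted `L¹` norm is the Cesàro norm itself and
no upgrade is needed. -/
theorem weakBanachSaks_ces_unitInterval (h : p = 1) :
    WeakBanachSaks (Ces p CesDomain.unitInterval) := by
  refine weakBanachSaks_of_tendsto_mean fun f hf => ?_
  obtain ⟨n, hn, hlim⟩ := exists_strictMono_tendsto_cesToL1 (Or.inr rfl) hf
  refine ⟨n, hn, ?_⟩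
  have hlim' := ENNReal.tendsto_ofReal hlim
  rw [ENNReal.ofReal_zero] at hlim'
  refine hlim'.congr fun m => ?_
  rw [ofReal_norm_cesToL1]
  subst h
  rw [← ENNReal.rpow_one (cesENorm _ _ _), cesENorm_rpow one_pos]
  simp

/-- On the half-line, the space `Ces_1` is trivial. -/
lemma cesENorm_one_halfLine {f : ℝ →ₘ[CesDomain.halfLine.measure] ℝ}
    (hf : cesENorm 1 CesDomain.halfLine f ≠ ∞) : f = 0 := by
  apply AEEqFun.ext
  have hzero : ∀ᵐ t ∂CesDomain.halfLine.measure, ‖f t‖ₑ = 0 := by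
    refine CesDomain.halfLine.ae_of_ae_Ioc (Q := fun _ => True) (ae_of_all _ fun _ => trivial)
      fun a ha _ => ?_
    refine (lintegral_eq_zero_iff' (aemeasurable_enorm f).restrict).1 ?_
    by_contra hc
    apply hf
    set c := ∫⁻ t in Ioc 0 a, ‖f t‖ₑ ∂CesDomain.halfLine.measure with hcdef
    have h1 := cesENorm_rpow one_pos f
    simp only [ENNReal.rpow_one] at h1
    rw [h1, ← top_le_iff]
    -- If `|f|` has integral `c ≠ 0` over `(0, a]`, its Cesàro mean is at least `c / x` for `x > a`,
    -- and `1 / x` is not integrable at infinity.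
    have hinv : ∫⁻ x in Ioi a, ENNReal.ofReal x⁻¹ = ∞ := by
      by_contra hfin
      refine not_integrableOn_Ioi_inv (a := a) ⟨by fun_prop, ?_⟩
      rw [hasFiniteIntegral_iff_ofReal]
      · exact lt_top_iff_ne_top.2 hfin
      · filter_upwards [ae_restrict_mem measurableSet_Ioi] with x hx
        exact inv_nonneg.2 (ha.trans hx).le
    calc ∞ = c * ∫⁻ x in Ioi a, ENNReal.ofReal x⁻¹ := by rw [hinv, ENNReal.mul_top hc]
      _ = ∫⁻ x in Ioi a, c * ENNReal.ofReal x⁻¹ :=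
          (lintegral_const_mul _ (by fun_prop)).symm
      _ ≤ ∫⁻ x in Ioi a, cesMean CesDomain.halfLine (fun t => ‖f t‖ₑ) x := by
          refine setLIntegral_mono' measurableSet_Ioi fun x hx => ?_
          rw [ENNReal.ofReal_inv_of_pos (ha.trans hx), ← div_eq_mul_inv]
          exact ENNReal.div_le_div_right
            (lintegral_mono_set (Ioc_subset_Ioc_right (le_of_lt hx))) _
      _ ≤ ∫⁻ x, cesMean CesDomain.halfLine (fun t => ‖f t‖ₑ) x ∂CesDomain.halfLine.measure :=
          lintegral_mono_set fun x hx => (ha.trans hx).le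
  filter_upwards [hzero, AEEqFun.coeFn_zero (α := ℝ) (β := ℝ) (μ := CesDomain.halfLine.measure)]
    with t h1 h2
  rw [h2]
  simpa using h1

theorem weakBanachSaks_ces_halfLine (h : p = 1) :
    WeakBanachSaks (Ces p CesDomain.halfLine) := by
  subst h
  intro f _
  have hzero : ∀ k, f k = 0 := fun k => Subtype.ext (cesENorm_one_halfLine (Ces.ne_top (f k)))
  exact ⟨id, strictMono_id, by simp [hzero]⟩

end Embedding

theorem theorem1 (p : ℝ) [Fact (1 ≤ p)] (I : CesDomain) : WeakBanachSaks (Ces p I) := by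
  rcases (Fact.out : 1 ≤ p).eq_or_lt with h | h
  · cases I with
    | unitInterval => exact weakBanachSaks_ces_unitInterval h.symm
    | halfLine => exact weakBanachSaks_ces_halfLine h.symm
  · exact weakBanachSaks_ces_of_one_lt h
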